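/- Let $M\ge 2$ be an integer and $p\in[0,1]$. Planar fractal percolation with parameters $M,p$ is constructed as follows: $F_0=J:=[0,1]^2$, and, given $F_{n-1}$, each of its constituent closed squares of side length $M^{-(n-1)}$ is divided into $M^2$ closed subsquares of side length $M^{-n}$, each of which is kept with probability $p$, independently of all other squares and of the previous steps; $F_n$ is the union of the squares kept in step $n$. Let $C_n:=\overline{J\setminus F_n}$, $r:=1/M$ and $D:=\log(M^2p)/\log M$. For a compact convex set $K\subset\mathbb R^2$ let $V_0(K),V_1(K),V_2(K)$ be its intrinsic volumes, i.e. the coefficients in the Steiner formula $\lambda_2(\{x:\operatorname{dist}(x,K)\le\varepsilon\})=V_2(K)+2V_1(K)\varepsilon+\pi V_0(K)\varepsilon^2$ $(\varepsilon\ge 0)$, and denote by the same symbols their additive (inclusion–exclusion) extensions to finite unions of compact convex sets, so that $V_0$ is the Euler characteristic. Put $$\overline{\mathcal V}_k(F):=\lim_{n\to\infty} r^{n(D-k)}\,\mathbb E V_k(F_n),\qquad \overline{\mathcal V}^c_k(F):=\lim_{n\to\infty} r^{n(D-k)}\,\mathbb E V_k(C_n).$$ If $p>1/M^2$, then the limit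 $\overline{\mathcal V}^c_0(F)$ exists and $$\overline{\mathcal V}^c_0(F)=M^2(1-p)\,\frac{p^3+(M-1)p^2+(M-1)p-M}{(M^2-p^3)(M-p)}.$$ If $p>1/M$, then the limits $\overline{\mathcal V}^c_1(F)$ and $\overline{\mathcal V}_1(F)$ exist and $$\overline{\mathcal V}^c_1(F)=\frac{2M(1-p)}{M-p}=\overline{\mathcal V}_1(F).$$ -/

import Mathlib

open MeasureTheory ProbabilityTheory Filter Topology Set

/-- `ℝ^d` with the Euclidean norm. -/
abbrev Space (d : ℕ) : Type := EuclideanSpace ℝ (Fin d)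

/-! ### Intrinsic volumes on the convex ring -/

/-- `κ_j`, the volume of the unit ball of `ℝ^j`. -/
noncomputable def unitBallVolume (j : ℕ) : ℝ :=
  volume.real (Metric.closedBall (0 : Space j) 1)

/-- The numbers `v 0, …, v d` are the (normalized) coefficients of the Steiner polynomial of `K`:
for every `ε ≥ 0` the Lebesgue measure of `{x | dist (x, K) ≤ ε}` equals
`∑ j, κ_{d-j} * v j * ε^{d-j}`. -/
def IsSteinerCoeffs {d : ℕ} (K : Set (Space d)) (v : Fin (d + 1) → ℝ) : Prop :=
  ∀ ε : ℝ, 0 ≤ ε → volume.real (Metric.cthickening ε K) =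
    ∑ j : Fin (d + 1), unitBallVolume (d - (j : ℕ)) * v j * ε ^ (d - (j : ℕ))

/-- `x` is the value at `K` of the additive extension of the `k`-th intrinsic volume to the convex
ring: `K` is a finite union of compact convex sets `A i`, and `x` is obtained by inclusion-exclusion
from the `k`-th intrinsic volumes (Steiner coefficients) of the nonempty intersections of
the `A i`. The coefficients `v T` always exist (Steiner's formula) and are unique, and `x`
does not depend on the representation of `K`. -/
def HasIntrinsicVolume {d : ℕ} (k : Fin (d + 1)) (K : Set (Space d)) (x : ℝ) : Prop :=
  ∃ (m : ℕ) (A : Fin m → Set (Space d)) (v : Finset (Fin m) → Fin (d + 1) → ℝ),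
    (∀ i, IsCompact (A i) ∧ Convex ℝ (A i)) ∧
    (⋃ i, A i) = K ∧
    (∀ T : Finset (Fin m), T.Nonempty → IsSteinerCoeffs (⋂ i ∈ T, A i) (v T)) ∧
    x = ∑ T : Finset (Fin m) with T.Nonempty, (-1 : ℝ) ^ (T.card + 1) * v T k

open Classical in
/-- The `k`-th intrinsic volume `V_k` on the convex ring of `ℝ^d`
(with value `0` at sets that are not polyconvex). -/
noncomputable def intrinsicVolume {d : ℕ} (k : Fin (d + 1)) (K : Set (Space d)) : ℝ :=
  if h : ∃ x, HasIntrinsicVolume k K x then h.choose else 0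

/-! ### Fractal percolation -/

/-- The unit cube `J = [0,1]^d`. -/
def unitCube (d : ℕ) : Set (Space d) := {x | ∀ i, x i ∈ Icc (0 : ℝ) 1}

/-- The `M^d` letters; the letter `j` stands for the subcube of `J` with lower corner `j / M`. -/
abbrev Letter (M d : ℕ) : Type := Fin d → Fin M

/-- The similarity `φ_j` that maps `J` onto its subcube `J_j`. -/
noncomputable def letterMap {M d : ℕ} (j : Letter M d) (x : Space d) : Space d :=
  WithLp.toLp 2 (fun i => (x i + ((j i : ℕ) : ℝ)) / (M : ℝ))

/-- `φ_{σ₁} ∘ φ_{σ₂} ∘ ⋯ ∘ φ_{σₙ}` for a word `σ = σ₁ σ₂ … σₙ`. -/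
noncomputable def wordMap {M d : ℕ} : List (Letter M d) → Space d → Space d
  | [] => id
  | j :: σ => letterMap j ∘ wordMap σ

/-- The subcube `J_σ` of level `σ.length`. -/
noncomputable def wordCube {M d : ℕ} (σ : List (Letter M d)) : Set (Space d) :=
  wordMap σ '' unitCube d

/-- `keep (σ, i)` is the event that the subcube `J_{σ i}` of `J_σ` is kept when `J_σ` is
subdivided. In a fractal percolation with parameters `M`, `p` these events are
independent and have probability `p`. -/
structure IsFractalPercolation {Ω : Type*} [MeasurableSpace Ω] (μ : Measure Ω) (M d : ℕ) (p : ℝ)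
    (keep : List (Letter M d) × Letter M d → Set Ω) : Prop where
  measurableSet : ∀ e, MeasurableSet (keep e)
  indep : iIndepSet keep μ
  prob : ∀ e, μ (keep e) = ENNReal.ofReal p

/-- The `n`-th generation `𝒯_n` of the random tree: the words `σ` of length `n` such that `J_σ` and
all the cubes of the previous levels that contain it as descendants were kept. -/
def generation {Ω : Type*} {M d : ℕ} (keep : List (Letter M d) × Letter M d → Set Ω) (ω : Ω) :
    ℕ → Set (List (Letter M d))
  | 0 => {[]}
  | n + 1 => {τ | ∃ σ ∈ generation keep ω n, ∃ i, ω ∈ keep (σ, i) ∧ τ = σ ++ [i]}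

/-- The `n`-th construction step `F_n`. -/
def percolationStep {Ω : Type*} {M d : ℕ} (keep : List (Letter M d) × Letter M d → Set Ω)
    (n : ℕ) (ω : Ω) : Set (Space d) :=
  ⋃ σ ∈ generation keep ω n, wordCube σ

/-- The closed complement `C_n`, the closure of `[0,1]^d \ F_n`. -/
def percolationCompl {Ω : Type*} {M d : ℕ} (keep : List (Letter M d) × Letter M d → Set Ω)
    (n : ℕ) (ω : Ω) : Set (Space d) :=
  closure (unitCube d \ percolationStep keep n ω)

/-- The number `D = log (M^d p) / log M`. -/
noncomputable def percolationDim (M d : ℕ) (p : ℝ) : ℝ :=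
  Real.log ((M : ℝ) ^ d * p) / Real.log (M : ℝ)

/-! `F_n` and `C_n` are unions of squares of the grid of mesh `M ^ (-n)`, and an intrinsic volume is
a linear functional of the indicator function. So it may be evaluated cell by cell on relatively
open cells: an open interval has Euler characteristic -1 and length `1 / N`, a point has 1 and 0,
and products of cells follow the product rule `prodValue`.

Linearity is the statement that `steinerSpan` is the graph of a function. If `∑ a_i 1_{K_i} = 0`
with compact convex `K_i`, then the `a_i` with nonempty `K_i` sum to zero, by slicing. Intersecting
the `K_i` with balls gives the same relation for the `ε`-neighbourhoods; integrating it and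
comparing coefficients of Steiner polynomials gives `∑ a_i v_i = 0`. This yields the cell formula
`intrinsicVolume_gridUnion`.

Taking expectations leaves probabilities. A cell misses `C_n` exactly when all squares around it are
kept, which has probability `p` to the number of their distinct ancestors. That number is `n + u + v
+ min u v`, where the depths `u`, `v` of the two coordinates count the levels at which the two
adjacent intervals have different ancestors (`ancestorCount_cellNeighbours`). For `V_1` vertices
carry weight zero, so for `F_n` only cells with one or two surrounding squares matter, and
inclusion-exclusion reduces the union to the same probabilities.

An interior grid point `i / M ^ n` has depth `multiplicity M i + 1`, and `(M - 1) * M ^ (n - 1 - j)`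
of them have depth `j + 1`. The expectations `1 - planeSum`, `2 - 2 * lineSum` and `4 * p ^ n - 2 *
lineSum` therefore become geometric sums in `p / M`, plus a double sum obeying a linear recursion.
After rescaling, the terms outside `lineSum` and `planeSum` vanish, which is why both `V_1` limits
agree. -/

/-! ### The Euler characteristic is well defined -/

open Classical in
/-- If a linear combination of indicator functions of nonempty compact intervals vanishes, then
the sum of its coefficients vanishes. -/
theorem sum_eq_zero_of_sum_Icc_eq_zero {ι : Type*} (s : Finset ι) (a l u : ι → ℝ)
    (hlu : ∀ i ∈ s, l i ≤ u i) (h : ∀ t, ∑ i ∈ s with t ∈ Icc (l i) (u i), a i = 0) :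
    ∑ i ∈ s, a i = 0 := by
  -- The intervals that contain `t` but no point just to the right of `t` are those ending at `t`.
  -- Subtracting the relation at a point slightly right of `t` from the relation at `t` isolates
  -- them.
  have key : ∀ t, ∑ i ∈ s with u i = t, a i = 0 := by
    intro t
    have ev : ∀ᶠ x in 𝓝[>] t, ∀ i ∈ s, x ∈ Icc (l i) (u i) ↔ l i ≤ t ∧ t < u i := by
      rw [Filter.eventually_all_finset]
      intro i _
      have h1 : ∀ᶠ x in 𝓝[>] t, t < x := self_mem_nhdsWithin
      rcases le_or_gt (l i) t with hl | hl
      · rcases lt_or_ge t (u i) with hu | hu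
        · filter_upwards [h1, mem_nhdsWithin_of_mem_nhds (Iio_mem_nhds hu)] with x hx hx'
          exact ⟨fun _ => ⟨hl, hu⟩, fun _ => ⟨hl.trans hx.le, le_of_lt hx'⟩⟩
        · filter_upwards [h1] with x hx
          exact ⟨fun hh => absurd (hh.2.trans hu) (not_le.2 hx), fun hh => absurd hh.2 (not_lt.2 hu)⟩
      · filter_upwards [mem_nhdsWithin_of_mem_nhds (Iio_mem_nhds hl)] with x hx
        exact ⟨fun hh => absurd hh.1 (not_le.2 hx), fun hh => absurd hh.1 (not_le.2 hl)⟩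
    obtain ⟨x, hx⟩ := ev.exists
    have hxs := h x
    rw [Finset.filter_congr hx] at hxs
    have hts := h t
    rw [← Finset.sum_filter_add_sum_filter_not _ (fun i => u i = t), Finset.filter_filter,
      Finset.filter_filter] at hts
    have e1 : s.filter (fun i => t ∈ Icc (l i) (u i) ∧ u i = t) = s.filter (fun i => u i = t) :=
      Finset.filter_congr fun i hi =>
        ⟨fun hh => hh.2, fun hh => ⟨⟨hh ▸ hlu i hi, hh.ge⟩, hh⟩⟩
    have e2 : s.filter (fun i => t ∈ Icc (l i) (u i) ∧ ¬u i = t) =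
        s.filter (fun i => l i ≤ t ∧ t < u i) :=
      Finset.filter_congr fun i hi =>
        ⟨fun hh => ⟨hh.1.1, lt_of_le_of_ne hh.1.2 (Ne.symm hh.2)⟩,
          fun hh => ⟨⟨hh.1, hh.2.le⟩, hh.2.ne'⟩⟩
    rw [e1, e2, hxs, add_zero] at hts
    exact hts
  rw [← Finset.sum_fiberwise_of_maps_to (t := s.image u) (fun i hi => Finset.mem_image_of_mem u hi)]
  exact Finset.sum_eq_zero fun t _ => key t

open Classical in
theorem sum_nonempty_eq_zero_real {ι : Type*} (s : Finset ι) (a : ι → ℝ) (K : ι → Set ℝ)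
    (hc : ∀ i, IsCompact (K i)) (hK : ∀ i, Convex ℝ (K i))
    (h : ∀ t, ∑ i ∈ s with t ∈ K i, a i = 0) : ∑ i ∈ s with (K i).Nonempty, a i = 0 := by
  have hI : ∀ i, (K i).Nonempty → K i = Icc (sInf (K i)) (sSup (K i)) := fun i hi =>
    eq_Icc_of_connected_compact ((hK i).isConnected hi) (hc i)
  refine sum_eq_zero_of_sum_Icc_eq_zero _ a (fun i => sInf (K i)) (fun i => sSup (K i)) ?_ ?_
  · intro i hi
    have hne := (Finset.mem_filter.1 hi).2
    have := hI i hne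
    rw [this] at hne
    exact nonempty_Icc.1 hne
  · intro t
    rw [Finset.filter_filter, ← h t]
    refine Finset.sum_congr (Finset.filter_congr fun i _ => ⟨fun hh => ?_, fun hh => ?_⟩) fun _ _ => rfl
    · rw [hI i hh.1]; exact hh.2
    · exact ⟨⟨t, hh⟩, hI i ⟨t, hh⟩ ▸ hh⟩

open Classical in
/-- The Euler characteristic is well defined on linear combinations of indicator functions of
compact convex subsets of the plane. -/
theorem sum_nonempty_eq_zero_plane {ι : Type*} (s : Finset ι) (a : ι → ℝ) (K : ι → Set (Space 2))
    (hc : ∀ i, IsCompact (K i)) (hK : ∀ i, Convex ℝ (K i))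
    (h : ∀ x, ∑ i ∈ s with x ∈ K i, a i = 0) : ∑ i ∈ s with (K i).Nonempty, a i = 0 := by
  have hcoord : ∀ (j : Fin 2) (S : Set (Space 2)), IsCompact S → Convex ℝ S →
      IsCompact ((fun x : Space 2 => x j) '' S) ∧ Convex ℝ ((fun x : Space 2 => x j) '' S) := by
    intro j S h1 h2
    exact ⟨h1.image (by fun_prop), h2.linear_image (EuclideanSpace.proj (𝕜 := ℝ) j).toLinearMap⟩
  have hline : ∀ t : ℝ, IsClosed {x : Space 2 | x 0 = t} ∧ Convex ℝ {x : Space 2 | x 0 = t} := by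
    intro t
    refine ⟨isClosed_eq (by fun_prop) continuous_const, ?_⟩
    exact (convex_singleton t).linear_preimage (EuclideanSpace.proj (𝕜 := ℝ) (0 : Fin 2)).toLinearMap
  -- A point `t` lies in the projection of `K i` iff the slice of `K i` over `t` is nonempty, so the
  -- one-dimensional case on each vertical line gives a relation between the projections, to which
  -- it applies once more.
  have hproj : ∀ t, ∑ i ∈ s with t ∈ (fun x : Space 2 => x 0) '' K i, a i = 0 := by
    intro t
    have := sum_nonempty_eq_zero_real s a
      (fun i => (fun x : Space 2 => x 1) '' (K i ∩ {x | x 0 = t}))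
      (fun i => (hcoord 1 _ ((hc i).inter_right (hline t).1) ((hK i).inter (hline t).2)).1)
      (fun i => (hcoord 1 _ ((hc i).inter_right (hline t).1) ((hK i).inter (hline t).2)).2) ?_
    · rw [← this]
      refine Finset.sum_congr (Finset.filter_congr fun i _ => ?_) fun _ _ => rfl
      rw [image_nonempty]
      exact ⟨fun ⟨x, hx, hx'⟩ => ⟨x, hx, hx'⟩, fun ⟨x, hx, hx'⟩ => ⟨x, hx, hx'⟩⟩
    · intro y
      rw [← h !₂[t, y]]
      refine Finset.sum_congr (Finset.filter_congr fun i _ => ?_) fun _ _ => rfl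
      constructor
      · rintro ⟨x, ⟨hx, hx0⟩, hx1⟩
        have : x = !₂[t, y] := by
          ext j; fin_cases j
          · exact hx0
          · exact hx1
        exact this ▸ hx
      · intro hx
        exact ⟨_, ⟨hx, rfl⟩, rfl⟩
  have := sum_nonempty_eq_zero_real s a (fun i => (fun x : Space 2 => x 0) '' K i)
    (fun i => (hcoord 0 _ (hc i) (hK i)).1) (fun i => (hcoord 0 _ (hc i) (hK i)).2) hproj
  simpa only [image_nonempty] using this

/-! ### Steiner coefficients as a linear functional -/

theorem IsCompact.volume_cthickening_ne_top {d : ℕ} {K : Set (Space d)} (hK : IsCompact K) (ε : ℝ) :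
    volume (Metric.cthickening ε K) ≠ ⊤ :=
  (hK.isBounded.cthickening).measure_lt_top.ne

/-- A point `x` is within `ε` of `K i` iff the compact convex set `K i ∩ closedBall x ε` is
nonempty. Restricting the relation to this ball and counting nonempty sets gives the pointwise
relation for the neighbourhoods, which is then integrated. -/
theorem sum_volume_cthickening_eq_zero {ι : Type*} (s : Finset ι) (a : ι → ℝ)
    (K : ι → Set (Space 2)) (hc : ∀ i, IsCompact (K i)) (hK : ∀ i, Convex ℝ (K i))
    (h : ∀ x, ∑ i ∈ s, a i * (K i).indicator 1 x = 0) {ε : ℝ} (hε : 0 ≤ ε) :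
    ∑ i ∈ s, a i * volume.real (Metric.cthickening ε (K i)) = 0 := by
  classical
  have hpt : ∀ x, ∑ i ∈ s, a i * (Metric.cthickening ε (K i)).indicator (1 : Space 2 → ℝ) x = 0 := by
    intro x
    have := sum_nonempty_eq_zero_plane s a (fun i => K i ∩ Metric.closedBall x ε)
      (fun i => (hc i).inter_right Metric.isClosed_closedBall)
      (fun i => (hK i).inter (convex_closedBall x ε)) ?_
    · rw [← this, Finset.sum_filter]
      refine Finset.sum_congr rfl fun i _ => ?_
      have : x ∈ Metric.cthickening ε (K i) ↔ (K i ∩ Metric.closedBall x ε).Nonempty := by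
        rw [(hc i).cthickening_eq_biUnion_closedBall hε]
        simp only [mem_iUnion, Metric.mem_closedBall, exists_prop]
        exact ⟨fun ⟨y, hy, hxy⟩ => ⟨y, hy, by rwa [Metric.mem_closedBall, dist_comm]⟩,
          fun ⟨y, hy, hxy⟩ => ⟨y, hy, by rwa [Metric.mem_closedBall, dist_comm] at hxy⟩⟩
      simp [indicator_apply, this]
    · intro y
      by_cases hy : y ∈ Metric.closedBall x ε
      · rw [← h y, Finset.sum_filter]
        refine Finset.sum_congr rfl fun i _ => ?_
        simp [indicator_apply, hy]
      · simp [hy]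
  have hint : ∀ i ∈ s, Integrable
      (fun x => a i * (Metric.cthickening ε (K i)).indicator (1 : Space 2 → ℝ) x) volume := by
    intro i _
    refine Integrable.const_mul ?_ _
    rw [integrable_indicator_iff Metric.isClosed_cthickening.measurableSet]
    exact integrableOn_const ((hc i).volume_cthickening_ne_top ε)
  have := integral_finsetSum s hint
  simp only [hpt, integral_zero] at this
  rw [this]
  refine Finset.sum_congr rfl fun i _ => ?_
  rw [integral_const_mul, integral_indicator_one Metric.isClosed_cthickening.measurableSet]

/-- The space of all pairs `(∑ a_i 1_{K_i}, ∑ a_i v_i)`, where the `K_i` are compact convex sets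
with Steiner coefficients `v_i`. -/
noncomputable def steinerSpan (d : ℕ) : Submodule ℝ ((Space d → ℝ) × (Fin (d + 1) → ℝ)) :=
  Submodule.span ℝ {q | ∃ K v, IsCompact K ∧ Convex ℝ K ∧ IsSteinerCoeffs K v ∧
    q = (K.indicator 1, v)}

theorem unitBallVolume_pos (j : ℕ) : 0 < unitBallVolume j := by
  refine ENNReal.toReal_pos ?_ (Metric.isBounded_closedBall.measure_lt_top).ne
  exact (Metric.measure_closedBall_pos volume _ one_pos).ne'

theorem eq_zero_of_steiner_polynomial {w : Fin 3 → ℝ}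
    (h : ∀ ε : ℝ, 0 ≤ ε →
      ∑ j : Fin (2 + 1), unitBallVolume (2 - (j : ℕ)) * w j * ε ^ (2 - (j : ℕ)) = 0) : w = 0 := by
  -- A quadratic polynomial is determined by its values at three points.
  have h0 := h 0 le_rfl
  have h1 := h 1 zero_le_one
  have h2 := h 2 zero_le_two
  simp [Fin.sum_univ_three, (unitBallVolume_pos _).ne'] at h0 h1 h2
  have k0 := (unitBallVolume_pos 2).ne'
  have k1 := (unitBallVolume_pos 1).ne'
  have e0 : w 2 = 0 := h0
  rw [e0] at h1 h2
  have e1 : unitBallVolume 2 * w 0 = 0 := by linarith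
  have e2 : unitBallVolume 1 * w 1 = 0 := by linarith
  ext j
  fin_cases j
  · exact (mul_eq_zero.1 e1).resolve_left k0
  · exact (mul_eq_zero.1 e2).resolve_left k1
  · exact e0

theorem eq_zero_of_mem_steinerSpan {w : Fin 3 → ℝ} (h : ((0 : Space 2 → ℝ), w) ∈ steinerSpan 2) :
    w = 0 := by
  obtain ⟨m, a, g, hg⟩ := Submodule.mem_span_set'.1 h
  choose K v hc hK hv hq using fun i => (g i).2
  have h1 : ∀ x, ∑ i, a i * (K i).indicator (1 : Space 2 → ℝ) x = 0 := by
    intro x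
    have := congrFun (congrArg Prod.fst hg) x
    simpa [Prod.fst_sum, hq] using this
  have h2 : ∀ j, w j = ∑ i, a i * v i j := by
    intro j
    have := congrFun (congrArg Prod.snd hg) j
    simpa [Prod.snd_sum, hq] using this.symm
  refine eq_zero_of_steiner_polynomial fun ε hε => ?_
  rw [← sum_volume_cthickening_eq_zero Finset.univ a K hc hK h1 hε]
  simp_rw [fun i => hv i ε hε, h2, Finset.mul_sum, Finset.sum_mul]
  rw [Finset.sum_comm]
  refine Finset.sum_congr rfl fun i _ => Finset.sum_congr rfl fun j _ => ?_
  ring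

/-- Makes every decomposition of an indicator function admissible for computing intrinsic volumes,
including decompositions into cells that are not closed. -/
theorem steinerSpan_unique {f : Space 2 → ℝ} {v w : Fin 3 → ℝ} (hv : (f, v) ∈ steinerSpan 2)
    (hw : (f, w) ∈ steinerSpan 2) : v = w := by
  have := (steinerSpan 2).sub_mem hv hw
  rw [Prod.mk_sub_mk, sub_self] at this
  exact sub_eq_zero.1 (eq_zero_of_mem_steinerSpan this)

theorem IsSteinerCoeffs.mem_steinerSpan {d : ℕ} {K : Set (Space d)} {v : Fin (d + 1) → ℝ}
    (hv : IsSteinerCoeffs K v) (hc : IsCompact K) (hK : Convex ℝ K) :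
    (K.indicator 1, v) ∈ steinerSpan d :=
  Submodule.subset_span ⟨K, v, hc, hK, hv, rfl⟩

theorem indicator_iUnion_eq_sum_inter {α : Type*} {m : ℕ} (A : Fin m → Set α) :
    (⋃ i, A i).indicator (1 : α → ℝ) = ∑ T : Finset (Fin m) with T.Nonempty,
      (-1 : ℝ) ^ (T.card + 1) • (⋂ i ∈ T, A i).indicator (1 : α → ℝ) := by
  ext x
  have := Finset.indicator_biUnion_eq_sum_powerset Finset.univ A (1 : α → ℝ) x
  simpa [Finset.sum_apply] using this

theorem HasIntrinsicVolume.exists_mem_steinerSpan {d : ℕ} {k : Fin (d + 1)} {K : Set (Space d)}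
    {x : ℝ} (h : HasIntrinsicVolume k K x) :
    ∃ v : Fin (d + 1) → ℝ, v k = x ∧ (K.indicator 1, v) ∈ steinerSpan d := by
  obtain ⟨m, A, v, hA, rfl, hv, rfl⟩ := h
  refine ⟨∑ T : Finset (Fin m) with T.Nonempty, (-1 : ℝ) ^ (T.card + 1) • v T, ?_, ?_⟩
  · simp [Finset.sum_apply]
  · rw [indicator_iUnion_eq_sum_inter, prod_mk_sum]
    refine Submodule.sum_mem _ fun T hT => ?_
    rw [← Prod.smul_mk]
    refine Submodule.smul_mem _ _ ?_
    have hT := (Finset.mem_filter.1 hT).2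
    obtain ⟨i, hi⟩ := hT
    refine (hv T ⟨i, hi⟩).mem_steinerSpan ?_ ?_
    · exact (hA i).1.of_isClosed_subset
        (isClosed_biInter fun j _ => (hA j).1.isClosed) (biInter_subset_of_mem hi)
    · exact convex_iInter₂ fun j _ => (hA j).2

/-- Eliminates the arbitrary choice in `intrinsicVolume`. Existence of a representation has to be
supplied separately, since otherwise the default value 0 is taken. -/
theorem intrinsicVolume_eq {k : Fin 3} {K : Set (Space 2)} {v : Fin 3 → ℝ}
    (hK : ∃ x, HasIntrinsicVolume (d := 2) k K x) (hv : (K.indicator 1, v) ∈ steinerSpan 2) :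
    intrinsicVolume (d := 2) k K = v k := by
  rw [intrinsicVolume, dif_pos hK]
  obtain ⟨w, hw, hw'⟩ := hK.choose_spec.exists_mem_steinerSpan
  rw [← hw, steinerSpan_unique hv hw']

/-! ### Steiner's formula for rectangles -/

/-- The rectangle `[a, b] × [c, d]`. -/
def rectangle (a b c d : ℝ) : Set (Space 2) := {x | x 0 ∈ Icc a b ∧ x 1 ∈ Icc c d}

theorem isCompact_rectangle (a b c d : ℝ) : IsCompact (rectangle a b c d) := by
  have : rectangle a b c d = (EuclideanSpace.equiv (Fin 2) ℝ) ⁻¹' Icc ![a, c] ![b, d] := by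
    ext x
    simp [rectangle, Pi.le_def, Fin.forall_fin_two]
    tauto
  rw [this]
  exact (EuclideanSpace.equiv (Fin 2) ℝ).toHomeomorph.isCompact_preimage.2 isCompact_Icc

theorem convex_rectangle (a b c d : ℝ) : Convex ℝ (rectangle a b c d) :=
  ((convex_Icc a b).linear_preimage (EuclideanSpace.proj (𝕜 := ℝ) (0 : Fin 2)).toLinearMap).inter
    ((convex_Icc c d).linear_preimage (EuclideanSpace.proj (𝕜 := ℝ) (1 : Fin 2)).toLinearMap)

/-- Half the excess length of the section at `t` of the `ε`-neighbourhood of a rectangle with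
first side `[a, b]`. -/
noncomputable def sectionExcess (a b ε t : ℝ) : ℝ := √(ε ^ 2 - (t - max a (min b t)) ^ 2)

theorem continuous_sectionExcess (a b ε : ℝ) : Continuous (sectionExcess a b ε) := by
  unfold sectionExcess; fun_prop

theorem mem_cthickening_rectangle {a b c d ε : ℝ} (hab : a ≤ b) (hcd : c ≤ d) (hε : 0 ≤ ε)
    (x : Space 2) : x ∈ Metric.cthickening ε (rectangle a b c d) ↔ x 0 ∈ Icc (a - ε) (b + ε) ∧
      x 1 ∈ Icc (c - sectionExcess a b ε (x 0)) (d + sectionExcess a b ε (x 0)) := by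
  rw [(isCompact_rectangle a b c d).cthickening_eq_biUnion_closedBall hε]
  simp only [mem_iUnion, Metric.mem_closedBall, exists_prop, EuclideanSpace.dist_eq,
    Fin.sum_univ_two, Real.dist_eq, sq_abs]
  constructor
  · rintro ⟨y, ⟨⟨h0, h0'⟩, h1, h1'⟩, hxy⟩
    rw [Real.sqrt_le_left hε] at hxy
    have hx0 : |x 0 - y 0| ≤ ε := abs_le_of_sq_le_sq (by nlinarith [sq_nonneg (x 1 - y 1)]) hε
    rw [abs_le] at hx0
    have hg : (x 0 - max a (min b (x 0))) ^ 2 ≤ (x 0 - y 0) ^ 2 := by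
      rcases le_total (x 0) a with h | h
      · rw [max_eq_left ((min_le_right _ _).trans h)]; nlinarith
      · rcases le_total (x 0) b with h' | h'
        · rw [min_eq_right h', max_eq_right h]; nlinarith [sq_nonneg (x 0 - y 0)]
        · rw [min_eq_left h', max_eq_right hab]; nlinarith
    have hx1 : |x 1 - y 1| ≤ sectionExcess a b ε (x 0) := by
      refine Real.abs_le_sqrt ?_
      linarith
    rw [abs_le] at hx1
    refine ⟨⟨?_, ?_⟩, ?_, ?_⟩ <;> linarith
  · rintro ⟨⟨h0, h0'⟩, h1, h1'⟩
    have hs : 0 ≤ sectionExcess a b ε (x 0) := Real.sqrt_nonneg _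
    have hg : (x 0 - max a (min b (x 0))) ^ 2 ≤ ε ^ 2 := by
      refine sq_le_sq' ?_ ?_
      · rcases le_total (x 0) a with h | h
        · rw [max_eq_left ((min_le_right _ _).trans h)]; linarith
        · rw [max_eq_right (le_min hab h)]; linarith [min_le_right b (x 0)]
      · rcases le_total (x 0) b with h' | h'
        · rw [min_eq_right h']; linarith [le_max_right a (x 0)]
        · rw [min_eq_left h', max_eq_right hab]; linarith
    have hsq : sectionExcess a b ε (x 0) ^ 2 = ε ^ 2 - (x 0 - max a (min b (x 0))) ^ 2 :=
      Real.sq_sqrt (by linarith)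
    -- The point of the rectangle nearest to `x` is obtained by clamping each coordinate.
    refine ⟨!₂[max a (min b (x 0)), max c (min d (x 1))], ?_, ?_⟩
    · simp [rectangle, hab, hcd]
    · rw [Real.sqrt_le_left hε]
      have : (x 1 - max c (min d (x 1))) ^ 2 ≤ sectionExcess a b ε (x 0) ^ 2 := by
        refine sq_le_sq' ?_ ?_
        · rcases le_total (x 1) c with h | h
          · rw [max_eq_left ((min_le_right _ _).trans h)]; linarith
          · rw [max_eq_right (le_min hcd h)]; linarith [min_le_right d (x 1)]
        · rcases le_total (x 1) d with h' | h'
          · rw [min_eq_right h']; linarith [le_max_right c (x 1)]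
          · rw [min_eq_left h', max_eq_right hcd]; linarith
      simp
      linarith

theorem volume_cthickening_rectangle_eq_integral {a b c d ε : ℝ} (hab : a ≤ b) (hcd : c ≤ d)
    (hε : 0 ≤ ε) : volume.real (Metric.cthickening ε (rectangle a b c d)) =
      ∫ t in (a - ε)..(b + ε), ((d - c) + 2 * sectionExcess a b ε t) := by
  set S := {q : ℝ × ℝ | q.1 ∈ Icc (a - ε) (b + ε) ∧
    q.2 ∈ Icc (c - sectionExcess a b ε q.1) (d + sectionExcess a b ε q.1)} with hS
  have hcont := continuous_sectionExcess a b ε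
  have hSm : MeasurableSet S := by
    have : IsClosed S := by
      simp only [hS, mem_Icc, ofPred_and]
      refine ((isClosed_le ?_ ?_).inter (isClosed_le ?_ ?_)).inter
        ((isClosed_le ?_ ?_).inter (isClosed_le ?_ ?_)) <;> fun_prop
    exact this.measurableSet
  have hmp : MeasurePreserving (fun x : Space 2 => (x 0, x 1)) volume volume :=
    (volume_preserving_finTwoArrow ℝ).comp (PiLp.volume_preserving_ofLp (Fin 2))
  have h1 : Metric.cthickening ε (rectangle a b c d) = (fun x : Space 2 => (x 0, x 1)) ⁻¹' S := by
    ext x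
    exact mem_cthickening_rectangle hab hcd hε x
  have hnn : ∀ t, 0 ≤ (d - c) + 2 * sectionExcess a b ε t := fun t => by
    have : 0 ≤ sectionExcess a b ε t := Real.sqrt_nonneg _
    linarith
  rw [h1, measureReal_def, hmp.measure_preimage hSm.nullMeasurableSet, Measure.volume_eq_prod,
    Measure.prod_apply hSm, intervalIntegral.integral_of_le (by linarith),
    ← integral_Icc_eq_integral_Ioc, integral_eq_lintegral_of_nonneg_ae (ae_of_all _ hnn)
      (by fun_prop), ← lintegral_indicator measurableSet_Icc]
  congr 1
  refine lintegral_congr fun t => ?_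
  by_cases ht : t ∈ Icc (a - ε) (b + ε)
  · have : Prod.mk t ⁻¹' S = Icc (c - sectionExcess a b ε t) (d + sectionExcess a b ε t) := by
      ext y
      simp only [hS, mem_preimage, mem_ofPred_eq, ht, true_and]
    rw [this, indicator_of_mem ht, Real.volume_Icc]
    congr 1
    ring
  · have : Prod.mk t ⁻¹' S = ∅ := by
      ext y
      simp only [hS, mem_preimage, mem_ofPred_eq, ht, false_and, mem_empty_iff_false]
    rw [this, indicator_of_notMem ht, measure_empty]

/-- Over `[a, b]` the excess is constantly `ε`; beyond either end it traces a quarter of a disc of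
radius `ε`. -/
theorem integral_sectionExcess {a b ε : ℝ} (hab : a ≤ b) (hε : 0 ≤ ε) :
    ∫ t in (a - ε)..(b + ε), sectionExcess a b ε t =
      (b - a) * ε + 2 * ∫ t in (0 : ℝ)..ε, √(ε ^ 2 - t ^ 2) := by
  have hi : ∀ u v, IntervalIntegrable (sectionExcess a b ε) volume u v := fun u v =>
    (continuous_sectionExcess a b ε).intervalIntegrable u v
  rw [← intervalIntegral.integral_add_adjacent_intervals (hi (a - ε) a) (hi a (b + ε)),
    ← intervalIntegral.integral_add_adjacent_intervals (hi a b) (hi b (b + ε))]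
  have h1 : ∫ t in (a - ε)..a, sectionExcess a b ε t = ∫ t in (0 : ℝ)..ε, √(ε ^ 2 - t ^ 2) := by
    have := intervalIntegral.integral_comp_sub_left (a := 0) (b := ε) (sectionExcess a b ε) a
    rw [sub_zero] at this
    rw [← this]
    refine intervalIntegral.integral_congr fun t ht => ?_
    rw [uIcc_of_le hε] at ht
    have : max a (min b (a - t)) = a := max_eq_left ((min_le_right _ _).trans (by linarith [ht.1]))
    simp only [sectionExcess, this]
    ring_nf
  have h2 : ∫ t in a..b, sectionExcess a b ε t = (b - a) * ε := by
    rw [← smul_eq_mul, ← intervalIntegral.integral_const]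
    refine intervalIntegral.integral_congr fun t ht => ?_
    rw [uIcc_of_le hab] at ht
    simp [sectionExcess, min_eq_right ht.2, max_eq_right ht.1, Real.sqrt_sq hε]
  have h3 : ∫ t in b..(b + ε), sectionExcess a b ε t = ∫ t in (0 : ℝ)..ε, √(ε ^ 2 - t ^ 2) := by
    have := intervalIntegral.integral_comp_add_left (a := 0) (b := ε) (sectionExcess a b ε) b
    rw [add_zero] at this
    rw [← this]
    refine intervalIntegral.integral_congr fun t ht => ?_
    rw [uIcc_of_le hε] at ht
    have : max a (min b (b + t)) = b := by
      rw [min_eq_left (by linarith [ht.1]), max_eq_right hab]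
    simp only [sectionExcess, this]
    ring_nf
  rw [h1, h2, h3]
  ring

theorem volume_cthickening_rectangle {a b c d ε : ℝ} (hab : a ≤ b) (hcd : c ≤ d) (hε : 0 ≤ ε) :
    volume.real (Metric.cthickening ε (rectangle a b c d)) = (d - c) * (b - a + 2 * ε) +
      2 * ((b - a) * ε + 2 * ∫ t in (0 : ℝ)..ε, √(ε ^ 2 - t ^ 2)) := by
  rw [volume_cthickening_rectangle_eq_integral hab hcd hε, intervalIntegral.integral_add
    (by simp) (((continuous_sectionExcess a b ε).const_mul 2).intervalIntegrable _ _),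
    intervalIntegral.integral_const_mul, integral_sectionExcess hab hε,
    intervalIntegral.integral_const, smul_eq_mul]
  ring

/-- The degenerate rectangle `{0}` has a disc as its neighbourhood, so the rectangle formula itself
evaluates the integral. -/
theorem four_mul_integral_sqrt {ε : ℝ} (hε : 0 ≤ ε) :
    4 * ∫ t in (0 : ℝ)..ε, √(ε ^ 2 - t ^ 2) = unitBallVolume 2 * ε ^ 2 := by
  have h := volume_cthickening_rectangle (le_refl (0 : ℝ)) (le_refl (0 : ℝ)) hε
  have h0 : rectangle 0 0 0 0 = {(0 : Space 2)} := by
    ext x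
    simp only [rectangle, Icc_self, mem_singleton_iff, mem_ofPred_eq]
    constructor
    · rintro ⟨h0, h1⟩
      ext j; fin_cases j
      · exact h0
      · exact h1
    · rintro rfl; simp
  rw [h0, Metric.cthickening_singleton _ hε, measureReal_def,
    Measure.addHaar_closedBall volume _ hε, ENNReal.toReal_mul, ENNReal.toReal_ofReal (by positivity),
    ← Measure.addHaar_closedBall_eq_addHaar_ball] at h
  simp only [finrank_euclideanSpace, Fintype.card_fin] at h
  rw [unitBallVolume, measureReal_def]
  linarith

theorem unitBallVolume_zero : unitBallVolume 0 = 1 := by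
  have : Metric.closedBall (0 : Space 0) 1 = univ := by
    ext x
    simp [Subsingleton.elim x 0]
  rw [unitBallVolume, measureReal_def, this,
    ← (PiLp.volume_preserving_toLp (Fin 0)).measure_preimage MeasurableSet.univ.nullMeasurableSet,
    volume_pi, Measure.pi_of_empty]
  simp

theorem unitBallVolume_one : unitBallVolume 1 = 2 := by
  rw [unitBallVolume, measureReal_def, InnerProductSpace.volume_closedBall_of_dim_odd (k := 0) (by simp)]
  simp

/-- The intrinsic volumes of a rectangle. -/
theorem isSteinerCoeffs_rectangle {a b c d : ℝ} (hab : a ≤ b) (hcd : c ≤ d) :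
    IsSteinerCoeffs (rectangle a b c d) ![1, (b - a) + (d - c), (b - a) * (d - c)] := by
  intro ε hε
  rw [volume_cthickening_rectangle hab hcd hε]
  have := four_mul_integral_sqrt hε
  simp [Fin.sum_univ_three, unitBallVolume_zero, unitBallVolume_one]
  linarith

theorem isSteinerCoeffs_empty {d : ℕ} : IsSteinerCoeffs (∅ : Set (Space d)) 0 := by
  intro ε _
  simp

theorem exists_isSteinerCoeffs_rectangle (a b c d : ℝ) :
    ∃ v : Fin 3 → ℝ, IsSteinerCoeffs (d := 2) (rectangle a b c d) v := by
  by_cases h : a ≤ b ∧ c ≤ d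
  · exact ⟨_, isSteinerCoeffs_rectangle h.1 h.2⟩
  · have : rectangle a b c d = ∅ := by
      rw [eq_empty_iff_forall_notMem]
      rintro x ⟨h0, h1⟩
      exact h ⟨h0.1.trans h0.2, h1.1.trans h1.2⟩
    exact ⟨0, this ▸ isSteinerCoeffs_empty⟩

theorem exists_iInter_rectangle {ι : Type*} (a b c d : ι → ℝ) (T : Finset ι) (hT : T.Nonempty) :
    ∃ a' b' c' d', ⋂ i ∈ T, rectangle (a i) (b i) (c i) (d i) = rectangle a' b' c' d' := by
  refine ⟨T.sup' hT a, T.inf' hT b, T.sup' hT c, T.inf' hT d, ?_⟩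
  ext x
  simp only [rectangle, mem_iInter, mem_ofPred_eq, mem_Icc, Finset.sup'_le_iff, Finset.le_inf'_iff]
  grind

/-- Excludes the default value of `intrinsicVolume`: intersections of rectangles are rectangles or
empty, so all Steiner coefficients exist. -/
theorem exists_hasIntrinsicVolume_biUnion_rectangle {ι : Type*} (s : Finset ι) (a b c d : ι → ℝ)
    (k : Fin 3) :
    ∃ x, HasIntrinsicVolume (d := 2) k (⋃ i ∈ s, rectangle (a i) (b i) (c i) (d i)) x := by
  classical
  let e := s.equivFin.symm
  have hv : ∀ T : Finset (Fin s.card), ∃ v : Fin 3 → ℝ, T.Nonempty → IsSteinerCoeffs (d := 2)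
      (⋂ i ∈ T, rectangle (a (e i)) (b (e i)) (c (e i)) (d (e i))) v := by
    intro T
    by_cases hT : T.Nonempty
    · obtain ⟨a', b', c', d', h⟩ := exists_iInter_rectangle (fun i => a (e i)) (fun i => b (e i))
        (fun i => c (e i)) (fun i => d (e i)) T hT
      obtain ⟨v, hv⟩ := exists_isSteinerCoeffs_rectangle a' b' c' d'
      exact ⟨v, fun _ => h ▸ hv⟩
    · exact ⟨0, fun h => absurd h hT⟩
  choose v hv using hv
  refine ⟨_, s.card, fun i => rectangle (a (e i)) (b (e i)) (c (e i)) (d (e i)), v,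
    fun i => ⟨isCompact_rectangle _ _ _ _, convex_rectangle _ _ _ _⟩, ?_, hv, rfl⟩
  ext x
  simp only [mem_iUnion, exists_prop]
  constructor
  · rintro ⟨i, hi⟩
    exact ⟨e i, (e i).2, hi⟩
  · rintro ⟨i, hi, hx⟩
    exact ⟨e.symm ⟨i, hi⟩, by simpa using hx⟩

/-! ### Products of functions on the line -/

/-- The space of all pairs `(∑ a_i 1_{I_i}, (∑ a_i, ∑ a_i |I_i|))` with compact intervals `I_i`. -/
noncomputable def lineSpan : Submodule ℝ ((ℝ → ℝ) × (ℝ × ℝ)) :=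
  Submodule.span ℝ {q | ∃ s t : ℝ, s ≤ t ∧ q = ((Icc s t).indicator 1, (1, t - s))}

/-- The intrinsic volumes of a product, in terms of those of the factors. -/
def prodValue (v w : ℝ × ℝ) : Fin 3 → ℝ := ![v.1 * w.1, v.2 * w.1 + v.1 * w.2, v.2 * w.2]

/-- Both components are bilinear, so it suffices to treat two closed intervals, where this is
Steiner's formula for a rectangle. -/
theorem prod_mem_steinerSpan {g h : ℝ → ℝ} {v w : ℝ × ℝ} (hg : (g, v) ∈ lineSpan)
    (hh : (h, w) ∈ lineSpan) :
    ((fun x => g (x 0) * h (x 1)), prodValue v w) ∈ steinerSpan 2 := by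
  suffices H : ∀ q ∈ lineSpan, ∀ r ∈ lineSpan,
      ((fun x : Space 2 => q.1 (x 0) * r.1 (x 1)), prodValue q.2 r.2) ∈ steinerSpan 2 from
    H _ hg _ hh
  intro q hq r hr
  refine Submodule.span_induction (p := fun q _ =>
    ((fun x : Space 2 => q.1 (x 0) * r.1 (x 1)), prodValue q.2 r.2) ∈ steinerSpan 2)
    ?_ ?_ ?_ ?_ hq
  · rintro _ ⟨s, t, hst, rfl⟩
    refine Submodule.span_induction (p := fun r _ =>
      ((fun x : Space 2 => (Icc s t).indicator (1 : ℝ → ℝ) (x 0) * r.1 (x 1)),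
        prodValue (1, t - s) r.2) ∈ steinerSpan 2) ?_ ?_ ?_ ?_ hr
    · rintro _ ⟨s', t', hst', rfl⟩
      have := (isSteinerCoeffs_rectangle hst hst').mem_steinerSpan (isCompact_rectangle _ _ _ _)
        (convex_rectangle _ _ _ _)
      convert this using 2
      · ext x
        simp only [rectangle, indicator_apply, mem_ofPred_eq]
        by_cases h1 : x 0 ∈ Icc s t <;> by_cases h2 : x 1 ∈ Icc s' t' <;> simp [h1, h2]
      · simp [prodValue]
    · convert (steinerSpan 2).zero_mem using 1
      ext x
      · simp
      · fin_cases x <;> simp [prodValue]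
    · intro a b _ _ ha hb
      convert (steinerSpan 2).add_mem ha hb using 1
      ext x
      · simp [mul_add]
      · fin_cases x <;> simp [prodValue] <;> ring
    · intro c a _ ha
      convert (steinerSpan 2).smul_mem c ha using 1
      ext x
      · simp; ring
      · fin_cases x <;> simp [prodValue] <;> ring
  · convert (steinerSpan 2).zero_mem using 1
    ext x
    · simp
    · fin_cases x <;> simp [prodValue]
  · intro a b _ _ ha hb
    convert (steinerSpan 2).add_mem ha hb using 1
    ext x
    · simp [add_mul]
    · fin_cases x <;> simp [prodValue] <;> ring
  · intro c a _ ha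
    convert (steinerSpan 2).smul_mem c ha using 1
    ext x
    · simp; ring
    · fin_cases x <;> simp [prodValue] <;> ring

/-! ### The cells of a grid -/

/-- The cells of the grid of mesh `1 / N` on the line: `inl i` stands for the open interval
`(i / N, (i + 1) / N)` and `inr i` for the point `i / N`. -/
def cellSet (N : ℕ) : ℕ ⊕ ℕ → Set ℝ
  | .inl i => {x | (i : ℝ) < x * N ∧ x * N < i + 1}
  | .inr i => {x | x * N = i}

/-- Euler characteristic and length of a cell. -/
noncomputable def cellValue (N : ℕ) : ℕ ⊕ ℕ → ℝ × ℝ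
  | .inl _ => (-1, 1 / N)
  | .inr _ => (1, 0)

/-- The cells that make up `[0, 1]`. -/
def cells (N : ℕ) : Finset (ℕ ⊕ ℕ) := (Finset.range N).disjSum (Finset.range (N + 1))

/-- The intervals `[a / N, (a + 1) / N]` in `[0, 1]` that contain a cell. -/
def cellNeighbours (N : ℕ) : ℕ ⊕ ℕ → Finset ℕ
  | .inl i => {i}
  | .inr i => {a ∈ Finset.range N | a = i ∨ a + 1 = i}

/-- An open interval is the closed one minus its two end points, whence Euler characteristic 1 - 1 -
1 = -1 and unchanged length. -/
theorem cell_mem_lineSpan {N : ℕ} (hN : 0 < N) (c : ℕ ⊕ ℕ) :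
    ((cellSet N c).indicator 1, cellValue N c) ∈ lineSpan := by
  have hN' : (0 : ℝ) < N := by exact_mod_cast hN
  have hpt : ∀ i : ℝ, (({x | x * N = i} : Set ℝ).indicator (1 : ℝ → ℝ), ((1, 0) : ℝ × ℝ)) ∈ lineSpan := by
    intro i
    refine Submodule.subset_span ⟨i / N, i / N, le_rfl, ?_⟩
    have : ({x | x * N = i} : Set ℝ) = {i / N} := by
      ext x
      simp [eq_div_iff hN'.ne']
    rw [Icc_self, this, sub_self]
  cases c with
  | inr i => exact hpt i
  | inl i =>
    have hI : ((Icc ((i : ℝ) / N) ((i + 1) / N)).indicator (1 : ℝ → ℝ),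
        ((1, ((i : ℝ) + 1) / N - i / N) : ℝ × ℝ)) ∈ lineSpan :=
      Submodule.subset_span ⟨_, _, by gcongr; linarith, rfl⟩
    have := lineSpan.sub_mem (lineSpan.sub_mem hI (hpt i)) (hpt (i + 1))
    convert this using 1
    refine Prod.ext ?_ ?_
    · ext x
      simp only [cellSet, indicator_apply, mem_ofPred_eq, Pi.one_apply, Prod.fst_sub, Pi.sub_apply,
        mem_Icc, div_le_iff₀ hN', le_div_iff₀ hN']
      grind
    · simp only [cellValue, Prod.mk_sub_mk]
      refine Prod.ext ?_ ?_
      · norm_num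
      · simp only; ring

/-- The cells partition `[0, 1]`, and which closed grid intervals contain a point depends only on
its cell. -/
theorem exists_cell {N : ℕ} {x : ℝ} (hx : x ∈ Icc (0 : ℝ) 1) :
    ∃ c ∈ cells N, (∀ c', x ∈ cellSet N c' ↔ c' = c) ∧
      ∀ a : ℕ, a ∈ cellNeighbours N c ↔ a < N ∧ (a : ℝ) ≤ x * N ∧ x * N ≤ a + 1 := by
  have h0 : 0 ≤ x * N := mul_nonneg hx.1 N.cast_nonneg
  have h1 : x * N ≤ N := mul_le_of_le_one_left N.cast_nonneg hx.2
  have hf := Nat.floor_le h0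
  have hf' := Nat.lt_floor_add_one (x * N)
  set i := ⌊x * N⌋₊ with hi
  rcases hf.eq_or_lt with he | hlt
  · have hiN : i ≤ N := by rw [← he] at h1; exact_mod_cast h1
    refine ⟨.inr i, by simp [cells]; omega, ?_, ?_⟩
    · rintro (j | j) <;> simp only [cellSet, mem_ofPred_eq, ← he]
      · norm_cast
        simp only [iff_false]
        omega
      · norm_cast
        simp [eq_comm]
    · intro a
      simp only [cellNeighbours, Finset.mem_filter, Finset.mem_range, ← he]
      norm_cast
      omega
  · have hiN : i < N := by
      have : (i : ℝ) < N := hlt.trans_le h1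
      exact_mod_cast this
    have hint : ∀ j : ℕ, ((j : ℝ) ≤ x * N → j ≤ i) ∧ (x * N ≤ j → i < j) := by
      intro j
      constructor
      · intro h
        exact Nat.le_floor h
      · intro h
        have : (i : ℝ) < j := hlt.trans_le h
        exact_mod_cast this
    refine ⟨.inl i, by simp [cells]; omega, ?_, ?_⟩
    · rintro (j | j) <;> simp only [cellSet, mem_ofPred_eq]
      · constructor
        · rintro ⟨h, h'⟩
          have e1 := (hint j).1 h.le
          have e2 := (hint (j + 1)).2 (by push_cast; exact h'.le)
          rw [show j = i by omega]
        · intro h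
          obtain rfl : j = i := Sum.inl_injective h
          exact ⟨hlt, hf'⟩
      · simp only [reduceCtorEq, iff_false]
        intro h
        have e1 := (hint j).1 h.ge
        have e2 := (hint j).2 h.le
        omega
    · intro a
      simp only [cellNeighbours, Finset.mem_singleton]
      constructor
      · rintro rfl
        exact ⟨hiN, hlt.le, hf'.le⟩
      · rintro ⟨_, h, h'⟩
        have e1 := (hint a).1 h
        have e2 := (hint (a + 1)).2 (by push_cast; exact h')
        omega

theorem cellSet_subset {N : ℕ} (hN : 0 < N) {c : ℕ ⊕ ℕ} (hc : c ∈ cells N) :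
    cellSet N c ⊆ Icc 0 1 := by
  have hN' : (0 : ℝ) < N := by exact_mod_cast hN
  intro x hx
  have key : ∀ i j : ℕ, j ≤ N → (i : ℝ) ≤ x * N → x * N ≤ j → x ∈ Icc (0 : ℝ) 1 := by
    intro i j hj h h'
    refine ⟨nonneg_of_mul_nonneg_left (i.cast_nonneg.trans h) hN', ?_⟩
    have : (j : ℝ) ≤ N := by exact_mod_cast hj
    exact (mul_le_iff_le_one_left hN').1 (h'.trans this)
  rcases c with i | i
  · simp [cells] at hc
    exact key i (i + 1) hc hx.1.le (by push_cast; exact hx.2.le)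
  · simp [cells] at hc
    exact key i i (by omega) (le_of_eq hx.symm) (le_of_eq hx)

theorem mem_unitCube_two {x : Space 2} :
    x ∈ unitCube 2 ↔ x 0 ∈ Icc (0 : ℝ) 1 ∧ x 1 ∈ Icc (0 : ℝ) 1 := by
  simp only [unitCube, mem_ofPred_eq, Fin.forall_fin_two]

/-- The closed square of side length `1 / N` with lower left corner `(a / N, b / N)`. -/
def gridSquare (N a b : ℕ) : Set (Space 2) :=
  rectangle ((a : ℝ) / N) ((a + 1) / N) ((b : ℝ) / N) ((b + 1) / N)

theorem mem_gridSquare {N : ℕ} (hN : 0 < N) {a b : ℕ} {x : Space 2} : x ∈ gridSquare N a b ↔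
    ((a : ℝ) ≤ x 0 * N ∧ x 0 * N ≤ a + 1) ∧ ((b : ℝ) ≤ x 1 * N ∧ x 1 * N ≤ b + 1) := by
  have hN' : (0 : ℝ) < N := by exact_mod_cast hN
  simp only [gridSquare, rectangle, mem_ofPred_eq, mem_Icc, div_le_iff₀ hN', le_div_iff₀ hN']

/-- The union of the squares of the grid of mesh `1 / N` on `[0, 1]²` with property `P`. -/
def gridUnion (N : ℕ) (P : ℕ → ℕ → Prop) : Set (Space 2) :=
  ⋃ (a : ℕ) (b : ℕ) (_ : a < N ∧ b < N ∧ P a b), gridSquare N a b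

open Classical in
theorem gridUnion_eq_biUnion_finset (N : ℕ) (P : ℕ → ℕ → Prop) : gridUnion N P =
    ⋃ q ∈ (Finset.range N ×ˢ Finset.range N).filter (fun q => P q.1 q.2), gridSquare N q.1 q.2 := by
  ext x
  simp only [gridUnion, mem_iUnion, Finset.mem_filter, Finset.mem_product, Finset.mem_range,
    exists_prop, Prod.exists, and_assoc]

theorem isClosed_gridUnion (N : ℕ) (P : ℕ → ℕ → Prop) : IsClosed (gridUnion N P) := by
  classical
  rw [gridUnion_eq_biUnion_finset]
  exact isClosed_biUnion_finset fun q _ => (isCompact_rectangle _ _ _ _).isClosed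

-- A cell of the plane grid is contained in the union or disjoint from it, and it is contained iff
-- an adjacent square has property `P`. The indicator is thus a sum of products of cell indicators.
open Classical in
theorem gridUnion_mem_steinerSpan {N : ℕ} (hN : 0 < N) (P : ℕ → ℕ → Prop) :
    ((gridUnion N P).indicator 1, ∑ c ∈ cells N, ∑ c' ∈ cells N,
      (if ∃ a ∈ cellNeighbours N c, ∃ b ∈ cellNeighbours N c', P a b then (1 : ℝ) else 0) •
        prodValue (cellValue N c) (cellValue N c')) ∈ steinerSpan 2 := by
  have hfun : (gridUnion N P).indicator (1 : Space 2 → ℝ) = ∑ c ∈ cells N, ∑ c' ∈ cells N,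
      (if ∃ a ∈ cellNeighbours N c, ∃ b ∈ cellNeighbours N c', P a b then (1 : ℝ) else 0) •
        (fun x : Space 2 => (cellSet N c).indicator (1 : ℝ → ℝ) (x 0) *
          (cellSet N c').indicator (1 : ℝ → ℝ) (x 1)) := by
    ext x
    simp only [Finset.sum_apply, Pi.smul_apply, smul_eq_mul]
    by_cases hx : x 0 ∈ Icc (0 : ℝ) 1 ∧ x 1 ∈ Icc (0 : ℝ) 1
    · obtain ⟨c, hc, hcx, hca⟩ := exists_cell hx.1
      obtain ⟨c', hc', hcx', hca'⟩ := exists_cell hx.2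
      rw [Finset.sum_eq_single_of_mem c hc, Finset.sum_eq_single_of_mem c' hc']
      · simp only [indicator_apply, hcx, hcx', hca, hca', if_true, Pi.one_apply, mul_one]
        congr 1
        simp only [gridUnion, mem_iUnion, mem_gridSquare hN, exists_prop, eq_iff_iff]
        grind
      · intro e _ he
        simp [indicator_apply, hcx', he]
      · intro e _ he
        simp [indicator_apply, hcx, he]
    · rw [Finset.sum_eq_zero, indicator_of_notMem]
      · intro h
        simp only [gridUnion, mem_iUnion, gridSquare, exists_prop] at h
        obtain ⟨a, b, ⟨ha, hb, _⟩, h1, h2⟩ := h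
        have hI : ∀ i : ℕ, i < N → Icc ((i : ℝ) / N) ((i + 1) / N) ⊆ Icc 0 1 := by
          intro i hi
          refine Icc_subset_Icc (by positivity) ?_
          rw [div_le_one (by exact_mod_cast hN)]
          exact_mod_cast hi
        exact hx ⟨hI a ha h1, hI b hb h2⟩
      · intro c hc
        refine Finset.sum_eq_zero fun c' hc' => ?_
        by_cases h0 : x 0 ∈ cellSet N c
        · have h1 : x 1 ∉ cellSet N c' := fun h1 =>
            hx ⟨cellSet_subset hN hc h0, cellSet_subset hN hc' h1⟩
          simp [h1]
        · simp [h0]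
  rw [hfun, prod_mk_sum]
  refine Submodule.sum_mem _ fun c _ => ?_
  rw [prod_mk_sum]
  refine Submodule.sum_mem _ fun c' _ => ?_
  rw [← Prod.smul_mk]
  exact Submodule.smul_mem _ _ (prod_mem_steinerSpan (cell_mem_lineSpan hN c) (cell_mem_lineSpan hN c'))

open Classical in
/-- The intrinsic volumes of a union of squares of a grid, as a sum over the cells of the grid. -/
theorem intrinsicVolume_gridUnion {N : ℕ} (hN : 0 < N) (P : ℕ → ℕ → Prop) (k : Fin 3) :
    intrinsicVolume (d := 2) k (gridUnion N P) = ∑ c ∈ cells N, ∑ c' ∈ cells N,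
      (if ∃ a ∈ cellNeighbours N c, ∃ b ∈ cellNeighbours N c', P a b then (1 : ℝ) else 0) *
        prodValue (cellValue N c) (cellValue N c') k := by
  rw [intrinsicVolume_eq (v := _) ?_ (gridUnion_mem_steinerSpan hN P)]
  · simp only [Finset.sum_apply, Pi.smul_apply, smul_eq_mul]
  · rw [gridUnion_eq_biUnion_finset]
    exact exists_hasIntrinsicVolume_biUnion_rectangle _ _ _ _ _ k

theorem gridSquare_subset_closure {N : ℕ} (hN : 0 < N) (a b : ℕ) : gridSquare N a b ⊆
    closure {x | ((a : ℝ) < x 0 * N ∧ x 0 * N < a + 1) ∧ ((b : ℝ) < x 1 * N ∧ x 1 * N < b + 1)} := by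
  have hN' : (0 : ℝ) < N := by exact_mod_cast hN
  have hlt : ∀ i : ℕ, (i : ℝ) / N ≠ (i + 1) / N := fun i h => by
    rw [div_left_inj' hN'.ne'] at h
    linarith
  intro x hx
  have hf : Continuous (fun q : ℝ × ℝ => (!₂[q.1, q.2] : Space 2)) := by fun_prop
  have hmem : (x 0, x 1) ∈ closure (Ioo ((a : ℝ) / N) ((a + 1) / N) ×ˢ
      Ioo ((b : ℝ) / N) ((b + 1) / N)) := by
    rw [closure_prod_eq, closure_Ioo (hlt a), closure_Ioo (hlt b)]
    exact hx
  have := image_closure_subset_closure_image hf ⟨_, hmem, rfl⟩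
  have hxe : (!₂[x 0, x 1] : Space 2) = x := by
    ext j; fin_cases j <;> rfl
  simp only [hxe] at this
  refine closure_mono ?_ this
  rintro _ ⟨q, ⟨⟨h1, h2⟩, h3, h4⟩, rfl⟩
  rw [div_lt_iff₀ hN'] at h1 h3
  rw [lt_div_iff₀ hN'] at h2 h4
  exact ⟨⟨h1, h2⟩, h3, h4⟩

/-- The closed complement of a union of squares of a grid consists of the other squares. -/
theorem closure_unitCube_diff_gridUnion {N : ℕ} (hN : 0 < N) (P : ℕ → ℕ → Prop) :
    closure (unitCube 2 \ gridUnion N P) = gridUnion N fun a b => ¬P a b := by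
  have hN' : (0 : ℝ) < N := by exact_mod_cast hN
  apply Subset.antisymm
  · refine closure_minimal ?_ (isClosed_gridUnion _ _)
    rintro x ⟨hx, hxP⟩
    rw [mem_unitCube_two] at hx
    have hne : ∀ t ∈ Icc (0 : ℝ) 1, ∃ i < N, (i : ℝ) ≤ t * N ∧ t * N ≤ i + 1 := by
      intro t ht
      rcases ht.2.eq_or_lt with rfl | h1
      · refine ⟨N - 1, by omega, ?_⟩
        rw [Nat.cast_sub hN]
        constructor <;> push_cast <;> linarith
      · have h0 : 0 ≤ t * N := mul_nonneg ht.1 N.cast_nonneg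
        refine ⟨⌊t * N⌋₊, ?_, Nat.floor_le h0, (Nat.lt_floor_add_one _).le⟩
        rw [Nat.floor_lt h0]
        nlinarith
    obtain ⟨a, ha, ha'⟩ := hne _ hx.1
    obtain ⟨b, hb, hb'⟩ := hne _ hx.2
    have hxs : x ∈ gridSquare N a b := (mem_gridSquare hN).2 ⟨ha', hb'⟩
    simp only [gridUnion, mem_iUnion, exists_prop] at hxP ⊢
    exact ⟨a, b, ⟨ha, hb, fun h => hxP ⟨a, b, ⟨ha, hb, h⟩, hxs⟩⟩, hxs⟩
  · intro x hx
    simp only [gridUnion, mem_iUnion, exists_prop] at hx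
    obtain ⟨a, b, ⟨ha, hb, hP⟩, hx⟩ := hx
    refine closure_mono ?_ (gridSquare_subset_closure hN a b hx)
    rintro y ⟨⟨h1, h2⟩, h3, h4⟩
    refine ⟨mem_unitCube_two.2 ⟨?_, ?_⟩, ?_⟩
    · exact cellSet_subset hN (c := .inl a) (by simp [cells, ha]) ⟨h1, h2⟩
    · exact cellSet_subset hN (c := .inl b) (by simp [cells, hb]) ⟨h3, h4⟩
    · intro hy
      simp only [gridUnion, mem_iUnion, exists_prop, mem_gridSquare hN] at hy
      obtain ⟨a', b', ⟨_, _, hP'⟩, ⟨h5, h6⟩, h7, h8⟩ := hy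
      -- The interior of a grid square meets no other closed square of the grid.
      have key : ∀ i j : ℕ, ∀ t : ℝ, (i : ℝ) < t → t < i + 1 → (j : ℝ) ≤ t → t ≤ j + 1 → i = j := by
        intro i j t e1 e2 e3 e4
        have f1 : (i : ℝ) < j + 1 := by linarith
        have f2 : (j : ℝ) < i + 1 := by linarith
        have f1' : i < j + 1 := by exact_mod_cast f1
        have f2' : j < i + 1 := by exact_mod_cast f2
        omega
      rw [key a a' _ h1 h2 h5 h6, key b b' _ h3 h4 h7 h8] at hP
      exact hP hP'

/-! ### Words and squares of a grid -/

/-- The last letter of the word that belongs to the square at position `(a, b)`. -/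
def gridLetter (M : ℕ) [NeZero M] (a b : ℕ) : Letter M 2 := ![Fin.ofNat M a, Fin.ofNat M b]

/-- The word of length `n` that belongs to the square at position `(a, b)` of the grid of mesh
`M ^ (-n)`. -/
def gridWord (M : ℕ) [NeZero M] : ℕ → ℕ → ℕ → List (Letter M 2)
  | 0, _, _ => []
  | n + 1, a, b => gridWord M n (a / M) (b / M) ++ [gridLetter M a b]

theorem wordMap_append_singleton {M d : ℕ} (σ : List (Letter M d)) (j : Letter M d) (x : Space d) :
    wordMap (σ ++ [j]) x = wordMap σ (letterMap j x) := by
  induction σ with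
  | nil => rfl
  | cons i σ ih => simp only [List.cons_append, wordMap, Function.comp_apply, ih]

/-- The number of squares of the grids of mesh `M ^ (-1), …, M ^ (-n)` that contain one of the
squares with position in `S` of the grid of mesh `M ^ (-n)`. -/
def ancestorCount (M n : ℕ) (S : Finset (ℕ × ℕ)) : ℕ :=
  ∑ k ∈ Finset.range n, (S.image fun q => (q.1 / M ^ k, q.2 / M ^ k)).card

theorem ancestorCount_succ (M n : ℕ) (S : Finset (ℕ × ℕ)) : ancestorCount M (n + 1) S =
    S.card + ancestorCount M n (S.image fun q => (q.1 / M, q.2 / M)) := by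
  rw [ancestorCount, Finset.sum_range_succ', add_comm, ancestorCount]
  congr 1
  · simp
  · refine Finset.sum_congr rfl fun k _ => ?_
    rw [Finset.image_image]
    simp [Function.comp_def, Nat.div_div_eq_div_mul, pow_succ']

theorem ancestorCount_singleton (M n : ℕ) (q : ℕ × ℕ) : ancestorCount M n {q} = n := by
  simp [ancestorCount]

section Words

variable {M : ℕ} [NeZero M]

@[simp]
theorem length_gridWord (n a b : ℕ) : (gridWord M n a b).length = n := by
  induction n generalizing a b with
  | zero => rfl
  | succ n ih => simp [gridWord, ih]

theorem wordMap_gridWord (n a b : ℕ) (ha : a < M ^ n) (hb : b < M ^ n) (x : Space 2) :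
    wordMap (gridWord M n a b) x =
      !₂[(x 0 + a) / (M : ℝ) ^ n, (x 1 + b) / (M : ℝ) ^ n] := by
  induction n generalizing a b x with
  | zero =>
    obtain rfl : a = 0 := by simpa using ha
    obtain rfl : b = 0 := by simpa using hb
    ext i
    fin_cases i <;> simp [gridWord, wordMap]
  | succ n ih =>
    have hM : (M : ℝ) ≠ 0 := NeZero.ne _
    rw [gridWord, wordMap_append_singleton,
      ih _ _ (Nat.div_lt_of_lt_mul (by rwa [pow_succ'] at ha))
        (Nat.div_lt_of_lt_mul (by rwa [pow_succ'] at hb))]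
    have key : ∀ (y : ℝ) (c : ℕ), ((y + ((c % M : ℕ) : ℝ)) / M + ((c / M : ℕ) : ℝ)) / (M : ℝ) ^ n =
        (y + c) / (M : ℝ) ^ (n + 1) := by
      intro y c
      have : (c : ℝ) = M * ((c / M : ℕ) : ℝ) + ((c % M : ℕ) : ℝ) := by
        exact_mod_cast (Nat.div_add_mod c M).symm
      rw [this]
      field_simp
      ring
    ext i
    fin_cases i <;> simp [letterMap, gridLetter, ← key]

theorem wordCube_gridWord {n a b : ℕ} (ha : a < M ^ n) (hb : b < M ^ n) :
    wordCube (gridWord M n a b) = gridSquare (M ^ n) a b := by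
  have hM : (0 : ℝ) < (M : ℝ) ^ n := pow_pos (by exact_mod_cast NeZero.pos M) n
  have hN : 0 < M ^ n := pow_pos (NeZero.pos M) n
  ext x
  simp only [wordCube, mem_image, wordMap_gridWord n a b ha hb, mem_unitCube_two,
    mem_gridSquare hN, Nat.cast_pow, mem_Icc]
  constructor
  · rintro ⟨y, ⟨⟨h1, h2⟩, h3, h4⟩, rfl⟩
    simp only [Matrix.cons_val_zero, Matrix.cons_val_one, div_mul_cancel₀ _ hM.ne']
    exact ⟨⟨by linarith, by linarith⟩, by linarith, by linarith⟩
  · rintro ⟨⟨h1, h2⟩, h3, h4⟩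
    refine ⟨!₂[x 0 * (M : ℝ) ^ n - a, x 1 * (M : ℝ) ^ n - b], ?_, ?_⟩
    · simp only [Matrix.cons_val_zero, Matrix.cons_val_one]
      exact ⟨⟨by linarith, by linarith⟩, by linarith, by linarith⟩
    · ext i
      fin_cases i <;> simp [hM.ne']

theorem exists_gridWord_of_mem_generation {Ω : Type*}
    {keep : List (Letter M 2) × Letter M 2 → Set Ω} {ω : Ω} {n : ℕ} {σ : List (Letter M 2)}
    (h : σ ∈ generation keep ω n) : ∃ a b, a < M ^ n ∧ b < M ^ n ∧ σ = gridWord M n a b := by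
  induction n generalizing σ with
  | zero => exact ⟨0, 0, by simp, by simp, h⟩
  | succ n ih =>
    obtain ⟨τ, hτ, i, _, rfl⟩ := h
    obtain ⟨a, b, ha, hb, rfl⟩ := ih hτ
    have hlt : ∀ c < M ^ n, ∀ r : Fin M, M * c + r < M ^ (n + 1) := by
      intro c hc r
      have : M * (c + 1) ≤ M * M ^ n := Nat.mul_le_mul_left _ hc
      rw [pow_succ']
      have := r.2
      lia
    have hdiv : ∀ (c : ℕ) (r : Fin M), (M * c + r) / M = c := fun c r => by
      rw [Nat.mul_add_div (NeZero.pos M), Nat.div_eq_of_lt r.2, add_zero]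
    have hmod : ∀ (c : ℕ) (r : Fin M), Fin.ofNat M (M * c + r) = r := fun c r => by
      ext
      simp [Nat.mod_eq_of_lt r.2]
    refine ⟨M * a + i 0, M * b + i 1, hlt a ha _, hlt b hb _, ?_⟩
    rw [gridWord, hdiv, hdiv, gridLetter, hmod, hmod]
    congr 2
    ext j
    fin_cases j <;> rfl

theorem percolationStep_eq_gridUnion {Ω : Type*}
    (keep : List (Letter M 2) × Letter M 2 → Set Ω) (n : ℕ) (ω : Ω) :
    percolationStep keep n ω =
      gridUnion (M ^ n) fun a b => gridWord M n a b ∈ generation keep ω n := by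
  ext x
  simp only [percolationStep, gridUnion, mem_iUnion, exists_prop]
  constructor
  · rintro ⟨σ, hσ, hx⟩
    obtain ⟨a, b, ha, hb, rfl⟩ := exists_gridWord_of_mem_generation hσ
    exact ⟨a, b, ⟨ha, hb, hσ⟩, wordCube_gridWord ha hb ▸ hx⟩
  · rintro ⟨a, b, ⟨ha, hb, h⟩, hx⟩
    exact ⟨_, h, (wordCube_gridWord ha hb).symm ▸ hx⟩

theorem percolationCompl_eq_gridUnion {Ω : Type*}
    (keep : List (Letter M 2) × Letter M 2 → Set Ω) (n : ℕ) (ω : Ω) :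
    percolationCompl keep n ω =
      gridUnion (M ^ n) fun a b => gridWord M n a b ∉ generation keep ω n := by
  rw [percolationCompl, percolationStep_eq_gridUnion,
    closure_unitCube_diff_gridUnion (pow_pos (NeZero.pos M) n)]

/-! ### The events that decide whether a square is kept -/

/-- The subdivision step in which the square at position `q` of the grid of mesh `M ^ (-(n + 1))`
is created. -/
def lastStep (M : ℕ) [NeZero M] (n : ℕ) (q : ℕ × ℕ) : List (Letter M 2) × Letter M 2 :=
  (gridWord M n (q.1 / M) (q.2 / M), gridLetter M q.1 q.2)

/-- The subdivision steps that decide whether the square at position `q` of the grid of mesh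
`M ^ (-n)` is kept. -/
def ancestorSteps (M : ℕ) [NeZero M] : ℕ → ℕ × ℕ → Finset (List (Letter M 2) × Letter M 2)
  | 0, _ => ∅
  | n + 1, q => insert (lastStep M n q) (ancestorSteps M n (q.1 / M, q.2 / M))

theorem gridWord_mem_generation_iff {Ω : Type*} {keep : List (Letter M 2) × Letter M 2 → Set Ω}
    {ω : Ω} {n : ℕ} (q : ℕ × ℕ) : gridWord M n q.1 q.2 ∈ generation keep ω n ↔
      ∀ e ∈ ancestorSteps M n q, ω ∈ keep e := by
  induction n generalizing q with
  | zero => simp [generation, gridWord, ancestorSteps]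
  | succ n ih =>
    rw [ancestorSteps, Finset.forall_mem_insert, ← ih, gridWord]
    constructor
    · rintro ⟨σ, hσ, i, hi, h⟩
      obtain ⟨rfl, h2⟩ := List.append_inj' h rfl
      obtain rfl := List.singleton_injective h2
      exact ⟨hi, hσ⟩
    · rintro ⟨h1, h2⟩
      exact ⟨_, h2, _, h1, rfl⟩

theorem length_lt_of_mem_ancestorSteps {n : ℕ} {q : ℕ × ℕ} {e : List (Letter M 2) × Letter M 2}
    (h : e ∈ ancestorSteps M n q) : e.1.length < n := by
  induction n generalizing q with
  | zero => simp [ancestorSteps] at h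
  | succ n ih =>
    rcases Finset.mem_insert.1 h with rfl | h
    · simp [lastStep]
    · exact (ih h).trans n.lt_succ_self

theorem gridLetter_eq_iff {a b a' b' : ℕ} :
    gridLetter M a b = gridLetter M a' b' ↔ a % M = a' % M ∧ b % M = b' % M := by
  simp [gridLetter, funext_iff, Fin.forall_fin_two, Fin.ext_iff]

theorem gridWord_inj {n a b a' b' : ℕ} (ha : a < M ^ n) (hb : b < M ^ n) (ha' : a' < M ^ n)
    (hb' : b' < M ^ n) (h : gridWord M n a b = gridWord M n a' b') : a = a' ∧ b = b' := by
  induction n generalizing a b a' b' with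
  | zero => simp at ha hb ha' hb'; omega
  | succ n ih =>
    rw [pow_succ'] at ha hb ha' hb'
    obtain ⟨h1, h2⟩ := List.append_inj' h rfl
    obtain ⟨e1, e2⟩ := ih (Nat.div_lt_of_lt_mul ha) (Nat.div_lt_of_lt_mul hb)
      (Nat.div_lt_of_lt_mul ha') (Nat.div_lt_of_lt_mul hb') h1
    obtain ⟨e3, e4⟩ := gridLetter_eq_iff.1 (List.singleton_injective h2)
    rw [← Nat.div_add_mod a M, ← Nat.div_add_mod b M, e1, e2, e3, e4, Nat.div_add_mod,
      Nat.div_add_mod]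
    exact ⟨rfl, rfl⟩

/-- Steps of different levels differ in word length, and within a level a step determines the square
it creates. Shared ancestors therefore count once, and nothing else coincides. -/
theorem card_biUnion_ancestorSteps (n : ℕ) (S : Finset (ℕ × ℕ))
    (hS : ∀ q ∈ S, q.1 < M ^ n ∧ q.2 < M ^ n) :
    (S.biUnion (ancestorSteps M n)).card = ancestorCount M n S := by
  induction n generalizing S with
  | zero =>
    rw [Finset.card_eq_zero.2 (by ext; simp [ancestorSteps])]
    simp [ancestorCount]
  | succ n ih =>
    have hdiv : ∀ q ∈ S, q.1 / M < M ^ n ∧ q.2 / M < M ^ n := fun q hq => by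
      have := hS q hq
      rw [pow_succ'] at this
      exact ⟨Nat.div_lt_of_lt_mul this.1, Nat.div_lt_of_lt_mul this.2⟩
    have hU : S.biUnion (ancestorSteps M (n + 1)) = S.image (lastStep M n) ∪
        (S.image fun q => (q.1 / M, q.2 / M)).biUnion (ancestorSteps M n) := by
      ext e
      simp only [Finset.mem_biUnion, ancestorSteps, Finset.mem_insert, Finset.mem_union,
        Finset.mem_image]
      grind
    rw [hU, Finset.card_union_of_disjoint, ancestorCount_succ, ih, Finset.card_image_of_injOn]
    · intro q hq q' hq' h
      obtain ⟨h1, h2⟩ := Prod.mk.inj h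
      obtain ⟨e1, e2⟩ := gridWord_inj (hdiv q hq).1 (hdiv q hq).2 (hdiv q' hq').1 (hdiv q' hq').2 h1
      obtain ⟨e3, e4⟩ := gridLetter_eq_iff.1 h2
      refine Prod.ext ?_ ?_
      · rw [← Nat.div_add_mod q.1 M, e1, e3, Nat.div_add_mod]
      · rw [← Nat.div_add_mod q.2 M, e2, e4, Nat.div_add_mod]
    · intro q hq
      obtain ⟨q', hq', rfl⟩ := Finset.mem_image.1 hq
      exact hdiv q' hq'
    · rw [Finset.disjoint_left]
      intro e he he'
      obtain ⟨q, _, rfl⟩ := Finset.mem_image.1 he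
      obtain ⟨q', _, h⟩ := Finset.mem_biUnion.1 he'
      have := length_lt_of_mem_ancestorSteps h
      simp [lastStep] at this

section Probability

variable {Ω : Type*} [MeasurableSpace Ω] {μ : Measure Ω} {p : ℝ}
  {keep : List (Letter M 2) × Letter M 2 → Set Ω}

theorem IsFractalPercolation.measurableSet_mem_generation (hF : IsFractalPercolation μ M 2 p keep)
    (n a b : ℕ) : MeasurableSet {ω | gridWord M n a b ∈ generation keep ω n} := by
  have : {ω | gridWord M n a b ∈ generation keep ω n} = ⋂ e ∈ ancestorSteps M n (a, b), keep e := by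
    ext ω
    simpa using gridWord_mem_generation_iff (keep := keep) (ω := ω) (n := n) (a, b)
  rw [this]
  exact Finset.measurableSet_biInter _ fun e _ => hF.measurableSet e

theorem IsFractalPercolation.measureReal_forall_mem_generation
    (hF : IsFractalPercolation μ M 2 p keep) (hp : 0 ≤ p) (n : ℕ) (S : Finset (ℕ × ℕ))
    (hS : ∀ q ∈ S, q.1 < M ^ n ∧ q.2 < M ^ n) :
    μ.real {ω | ∀ q ∈ S, gridWord M n q.1 q.2 ∈ generation keep ω n} =
      p ^ ancestorCount M n S := by
  have : {ω | ∀ q ∈ S, gridWord M n q.1 q.2 ∈ generation keep ω n} =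
      ⋂ e ∈ S.biUnion (ancestorSteps M n), keep e := by
    ext ω
    simp only [gridWord_mem_generation_iff, mem_ofPred_eq, mem_iInter, Finset.mem_biUnion]
    grind
  rw [this, measureReal_def, hF.indep.meas_biInter]
  simp only [hF.prob, Finset.prod_const, card_biUnion_ancestorSteps n S hS, ENNReal.toReal_pow,
    ENNReal.toReal_ofReal hp]

/-- Inclusion-exclusion for two squares; for a single square the last term is `p ^ n`, so the same
formula remains valid. -/
theorem IsFractalPercolation.measureReal_exists_mem_generation [IsProbabilityMeasure μ]
    (hF : IsFractalPercolation μ M 2 p keep) (hp : 0 ≤ p) (n : ℕ) (S : Finset (ℕ × ℕ))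
    (hS : ∀ q ∈ S, q.1 < M ^ n ∧ q.2 < M ^ n) (hcard : S.card = 1 ∨ S.card = 2) :
    μ.real {ω | ∃ q ∈ S, gridWord M n q.1 q.2 ∈ generation keep ω n} =
      2 * p ^ n - p ^ ancestorCount M n S := by
  have h1 : ∀ q ∈ S, μ.real {ω | gridWord M n q.1 q.2 ∈ generation keep ω n} = p ^ n := by
    intro q hq
    have := hF.measureReal_forall_mem_generation hp n {q} (by simpa using hS q hq)
    rw [ancestorCount_singleton] at this
    simpa using this
  rcases hcard with h | h
  · obtain ⟨q, rfl⟩ := Finset.card_eq_one.1 h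
    rw [ancestorCount_singleton]
    simp only [Finset.mem_singleton, exists_eq_left]
    rw [h1 q (by simp)]
    ring
  · obtain ⟨q, q', _, rfl⟩ := Finset.card_eq_two.1 h
    rw [← hF.measureReal_forall_mem_generation hp n _ hS]
    have := measureReal_union_add_inter (μ := μ)
      (s := {ω | gridWord M n q.1 q.2 ∈ generation keep ω n})
      (hF.measurableSet_mem_generation n q'.1 q'.2)
    rw [h1 q (by simp), h1 q' (by simp)] at this
    simp only [Finset.mem_insert, Finset.mem_singleton, exists_eq_or_imp, forall_eq_or_imp,
      exists_eq_left, forall_eq]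
    rw [ofPred_or, ofPred_and]
    linarith

end Probability

end Words

/-! ### Expected intrinsic volumes -/

theorem integrable_and_integral_intrinsicVolume_gridUnion {Ω : Type*} [MeasurableSpace Ω]
    {μ : Measure Ω} [IsProbabilityMeasure μ] {N : ℕ} (hN : 0 < N) (P : Ω → ℕ → ℕ → Prop)
    (hP : ∀ a b, MeasurableSet {ω | P ω a b}) (k : Fin 3) :
    Integrable (fun ω => intrinsicVolume (d := 2) k (gridUnion N (P ω))) μ ∧
    ∫ ω, intrinsicVolume (d := 2) k (gridUnion N (P ω)) ∂μ = ∑ c ∈ cells N, ∑ c' ∈ cells N,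
      μ.real {ω | ∃ q ∈ cellNeighbours N c ×ˢ cellNeighbours N c', P ω q.1 q.2} *
        prodValue (cellValue N c) (cellValue N c') k := by
  classical
  have hm : ∀ S : Finset (ℕ × ℕ), MeasurableSet {ω | ∃ q ∈ S, P ω q.1 q.2} := by
    intro S
    have : {ω | ∃ q ∈ S, P ω q.1 q.2} = ⋃ q ∈ S, {ω | P ω q.1 q.2} := by
      ext ω; simp
    rw [this]
    exact Finset.measurableSet_biUnion _ fun q _ => hP q.1 q.2
  have hfun : (fun ω => intrinsicVolume (d := 2) k (gridUnion N (P ω))) =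
      fun ω => ∑ c ∈ cells N, ∑ c' ∈ cells N,
        {ω | ∃ q ∈ cellNeighbours N c ×ˢ cellNeighbours N c', P ω q.1 q.2}.indicator 1 ω *
          prodValue (cellValue N c) (cellValue N c') k := by
    ext ω
    rw [intrinsicVolume_gridUnion hN]
    refine Finset.sum_congr rfl fun c _ => Finset.sum_congr rfl fun c' _ => ?_
    congr 1
    simp only [indicator_apply, mem_ofPred_eq, Finset.mem_product, Prod.exists, Pi.one_apply]
    congr 1
    grind
  have hint : ∀ c c', Integrable (fun ω =>
      {ω | ∃ q ∈ cellNeighbours N c ×ˢ cellNeighbours N c', P ω q.1 q.2}.indicator (1 : Ω → ℝ) ω *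
          prodValue (cellValue N c) (cellValue N c') k) μ := by
    intro c c'
    refine Integrable.mul_const ?_ _
    exact (integrable_const (1 : ℝ)).indicator (hm _)
  rw [hfun]
  refine ⟨integrable_finsetSum _ fun c _ => integrable_finsetSum _ fun c' _ => hint c c', ?_⟩
  rw [integral_finsetSum _ fun c _ => integrable_finsetSum _ fun c' _ => hint c c']
  refine Finset.sum_congr rfl fun c _ => ?_
  rw [integral_finsetSum _ fun c' _ => hint c c']
  refine Finset.sum_congr rfl fun c' _ => ?_
  rw [integral_mul_const, integral_indicator_one (hm _)]

/-! ### Counting the ancestors of the neighbours of a cell -/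

open Classical in
/-- The number of levels on which the two intervals of the grid of mesh `M ^ (-n)` that meet
in a cell lie in different intervals of the grid of that level (and `0` if the cell lies in just
one interval). -/
noncomputable def cellDepth (M n : ℕ) : ℕ ⊕ ℕ → ℕ
  | .inl _ => 0
  | .inr i => if 0 < i ∧ i < M ^ n then multiplicity M i + 1 else 0

theorem pow_dvd_iff_lt_multiplicity_add_one {M i k : ℕ} (hM : 2 ≤ M) (hi : 0 < i) :
    M ^ k ∣ i ↔ k < multiplicity M i + 1 := by
  have hfin : FiniteMultiplicity M i := Nat.finiteMultiplicity_iff.2 ⟨by omega, hi⟩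
  rw [hfin.pow_dvd_iff_le_multiplicity, Nat.lt_succ_iff]

theorem cellDepth_le {M : ℕ} (hM : 2 ≤ M) (n : ℕ) (c : ℕ ⊕ ℕ) : cellDepth M n c ≤ n := by
  rcases c with i | i
  · simp [cellDepth]
  · rw [cellDepth]
    split_ifs with h
    · by_contra hlt
      have := Nat.le_of_dvd h.1 ((pow_dvd_iff_lt_multiplicity_add_one hM h.1).2 (not_le.1 hlt))
      omega
    · exact Nat.zero_le _

theorem card_image_div_pair (i m : ℕ) :
    (({i, i + 1} : Finset ℕ).image (· / m)).card = 1 + if m ∣ i + 1 then 1 else 0 := by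
  rw [Finset.image_insert, Finset.image_singleton, Nat.succ_div]
  split_ifs with h
  · exact Finset.card_pair (by omega)
  · simp

/-- The intervals on both sides of `i / M ^ n` have different ancestors `k` levels up iff `M ^ k ∣
i`, that is, iff `k ≤ multiplicity M i`. -/
theorem card_image_div_cellNeighbours {M n : ℕ} (hM : 2 ≤ M) {c : ℕ ⊕ ℕ} (hc : c ∈ cells (M ^ n))
    (k : ℕ) : ((cellNeighbours (M ^ n) c).image (· / M ^ k)).card =
      1 + if k < cellDepth M n c then 1 else 0 := by
  have hN : 0 < M ^ n := pow_pos (by omega) n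
  rcases c with i | i
  · simp [cellNeighbours, cellDepth]
  · simp only [cells, Finset.inr_mem_disjSum, Finset.mem_range] at hc
    rw [cellDepth]
    by_cases h : 0 < i ∧ i < M ^ n
    · obtain ⟨j, rfl⟩ : ∃ j, i = j + 1 := ⟨i - 1, by omega⟩
      have : cellNeighbours (M ^ n) (.inr (j + 1)) = {j, j + 1} := by
        ext a
        simp only [cellNeighbours, Finset.mem_filter, Finset.mem_range, Finset.mem_insert,
          Finset.mem_singleton]
        omega
      rw [this, card_image_div_pair, if_pos h]
      simp only [pow_dvd_iff_lt_multiplicity_add_one hM h.1]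
    · have : ∃ a, cellNeighbours (M ^ n) (.inr i) = {a} := by
        -- Here `i` is 0 or `M ^ n`; truncated subtraction gives the correct interval 0 or `M ^ n -
        -- 1` in both cases.
        refine ⟨i - 1, ?_⟩
        ext a
        simp only [cellNeighbours, Finset.mem_filter, Finset.mem_range, Finset.mem_singleton]
        omega
      obtain ⟨a, ha⟩ := this
      simp [ha, h]

theorem sum_range_card_mul_card {n u v : ℕ} (hu : u ≤ n) (hv : v ≤ n) :
    ∑ k ∈ Finset.range n, (1 + if k < u then 1 else 0) * (1 + if k < v then 1 else 0) =
      n + u + v + min u v := by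
  have hcount : ∀ w ≤ n, ∑ k ∈ Finset.range n, (if k < w then 1 else 0) = w := by
    intro w hw
    rw [← Finset.sum_filter, Finset.sum_const, smul_eq_mul, mul_one]
    have : (Finset.range n).filter (· < w) = Finset.range w := by
      ext k; simp only [Finset.mem_filter, Finset.mem_range]; omega
    rw [this, Finset.card_range]
  have : ∀ k, (1 + if k < u then 1 else 0) * (1 + if k < v then 1 else 0) =
      1 + (if k < u then 1 else 0) + (if k < v then 1 else 0) + if k < min u v then 1 else 0 := by
    intro k
    simp only [lt_min_iff]
    split_ifs <;> first | rfl | omega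
  simp only [this, Finset.sum_add_distrib, hcount u hu, hcount v hv,
    hcount (min u v) ((min_le_left _ _).trans hu)]
  simp

/-- On each level the ancestors of a product set form a product, so the counts (1 or 2 per
coordinate) multiply. The term `min` comes from the levels where both coordinates are split. -/
theorem ancestorCount_cellNeighbours {M n : ℕ} (hM : 2 ≤ M) {c c' : ℕ ⊕ ℕ}
    (hc : c ∈ cells (M ^ n)) (hc' : c' ∈ cells (M ^ n)) :
    ancestorCount M n (cellNeighbours (M ^ n) c ×ˢ cellNeighbours (M ^ n) c') =
      n + cellDepth M n c + cellDepth M n c' + min (cellDepth M n c) (cellDepth M n c') := by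
  rw [← sum_range_card_mul_card (cellDepth_le hM n c) (cellDepth_le hM n c'), ancestorCount]
  refine Finset.sum_congr rfl fun k _ => ?_
  rw [← card_image_div_cellNeighbours hM hc, ← card_image_div_cellNeighbours hM hc',
    ← Finset.card_product]
  congr 1
  ext q
  simp only [Finset.mem_image, Finset.mem_product, Prod.exists, Prod.ext_iff]
  grind

theorem lt_of_mem_cellNeighbours {N : ℕ} {c : ℕ ⊕ ℕ} (hc : c ∈ cells N) {a : ℕ}
    (ha : a ∈ cellNeighbours N c) : a < N := by
  rcases c with i | i
  · simp [cells] at hc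
    simp [cellNeighbours] at ha
    omega
  · simp [cellNeighbours] at ha
    omega

theorem card_cellNeighbours {M n : ℕ} (hM : 2 ≤ M) {c : ℕ ⊕ ℕ} (hc : c ∈ cells (M ^ n)) :
    (cellNeighbours (M ^ n) c).card = 1 ∨ (cellNeighbours (M ^ n) c).card = 2 := by
  have := card_image_div_cellNeighbours hM hc 0
  simp only [pow_zero, Nat.div_one, Finset.image_id'] at this
  rw [this]
  split_ifs <;> simp

/-- Only vertices can touch more than two squares, and a product of two points has `V_1` equal to
zero. -/
theorem card_cellNeighbours_prod_of_value_ne_zero {M n : ℕ} (hM : 2 ≤ M) {c c' : ℕ ⊕ ℕ}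
    (hc : c ∈ cells (M ^ n)) (hc' : c' ∈ cells (M ^ n))
    (h : prodValue (cellValue (M ^ n) c) (cellValue (M ^ n) c') 1 ≠ 0) :
    (cellNeighbours (M ^ n) c ×ˢ cellNeighbours (M ^ n) c').card = 1 ∨
      (cellNeighbours (M ^ n) c ×ˢ cellNeighbours (M ^ n) c').card = 2 := by
  rw [Finset.card_product]
  rcases c with i | i
  · simpa [cellNeighbours] using card_cellNeighbours hM hc'
  · rcases c' with j | j
    · have := card_cellNeighbours hM hc
      simpa [cellNeighbours] using this
    · exact absurd (by simp [prodValue, cellValue]) h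

/-! ### The expected intrinsic volumes as sums over cells -/

theorem sum_cells (N : ℕ) (f : ℕ ⊕ ℕ → ℝ) : ∑ c ∈ cells N, f c =
    ∑ i ∈ Finset.range N, f (.inl i) + ∑ i ∈ Finset.range (N + 1), f (.inr i) :=
  Finset.sum_disjSum _ _ _

theorem sum_cellValue_fst (N : ℕ) : ∑ c ∈ cells N, (cellValue N c).1 = 1 := by
  simp [sum_cells, cellValue]

/-- Points have length zero, and the open intervals all have depth 0 and total length 1. -/
theorem sum_cellValue_snd_mul {M : ℕ} (hM : 2 ≤ M) (n : ℕ) (f : ℕ → ℝ) :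
    ∑ c ∈ cells (M ^ n), (cellValue (M ^ n) c).2 * f (cellDepth M n c) = f 0 := by
  have : (M : ℝ) ≠ 0 := by positivity
  simp [sum_cells, cellValue, cellDepth]
  field_simp

theorem sum_prodValue_zero {N : ℕ} (f : ℕ ⊕ ℕ → ℕ ⊕ ℕ → ℝ) :
    ∑ c ∈ cells N, ∑ c' ∈ cells N, f c c' * prodValue (cellValue N c) (cellValue N c') 0 =
      ∑ c ∈ cells N, ∑ c' ∈ cells N, f c c' * ((cellValue N c).1 * (cellValue N c').1) := rfl

theorem sum_prodValue_one {M : ℕ} (hM : 2 ≤ M) (n : ℕ) (f : ℕ → ℕ → ℝ) :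
    ∑ c ∈ cells (M ^ n), ∑ c' ∈ cells (M ^ n), f (cellDepth M n c) (cellDepth M n c') *
        prodValue (cellValue (M ^ n) c) (cellValue (M ^ n) c') 1 =
      ∑ c ∈ cells (M ^ n), (cellValue (M ^ n) c).1 * f 0 (cellDepth M n c) +
      ∑ c ∈ cells (M ^ n), (cellValue (M ^ n) c).1 * f (cellDepth M n c) 0 := by
  have h : ∀ c c', f (cellDepth M n c) (cellDepth M n c') *
      prodValue (cellValue (M ^ n) c) (cellValue (M ^ n) c') 1 =
      (cellValue (M ^ n) c').1 *
        ((cellValue (M ^ n) c).2 * f (cellDepth M n c) (cellDepth M n c')) +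
      (cellValue (M ^ n) c).1 *
        ((cellValue (M ^ n) c').2 * f (cellDepth M n c) (cellDepth M n c')) := by
    intro c c'
    simp only [prodValue, Matrix.cons_val_one, Matrix.cons_val_zero]
    ring
  simp only [h, Finset.sum_add_distrib]
  congr 1
  · rw [Finset.sum_comm]
    refine Finset.sum_congr rfl fun c _ => ?_
    rw [← Finset.mul_sum,
      sum_cellValue_snd_mul hM n (fun u => f u (cellDepth M n c))]
  · refine Finset.sum_congr rfl fun c _ => ?_
    rw [← Finset.mul_sum, sum_cellValue_snd_mul hM n (fun u => f (cellDepth M n c) u)]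

section Expectation

variable {M : ℕ} [NeZero M] {Ω : Type*} [MeasurableSpace Ω] {μ : Measure Ω}
  [IsProbabilityMeasure μ] {p : ℝ} {keep : List (Letter M 2) × Letter M 2 → Set Ω}

theorem IsFractalPercolation.integrable_and_integral_percolationCompl
    (hF : IsFractalPercolation μ M 2 p keep) (hp : 0 ≤ p) (hM : 2 ≤ M) (n : ℕ) (k : Fin 3) :
    Integrable (fun ω => intrinsicVolume (d := 2) k (percolationCompl keep n ω)) μ ∧
    ∫ ω, intrinsicVolume (d := 2) k (percolationCompl keep n ω) ∂μ =
      ∑ c ∈ cells (M ^ n), ∑ c' ∈ cells (M ^ n),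
        (1 - p ^ (n + cellDepth M n c + cellDepth M n c' +
          min (cellDepth M n c) (cellDepth M n c'))) *
        prodValue (cellValue (M ^ n) c) (cellValue (M ^ n) c') k := by
  simp only [percolationCompl_eq_gridUnion]
  have h := integrable_and_integral_intrinsicVolume_gridUnion (μ := μ) (pow_pos (NeZero.pos M) n)
    (fun ω a b => gridWord M n a b ∉ generation keep ω n)
    (fun a b => (hF.measurableSet_mem_generation n a b).compl) k
  refine ⟨h.1, h.2.trans ?_⟩
  refine Finset.sum_congr rfl fun c hc => Finset.sum_congr rfl fun c' hc' => ?_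
  rw [← ancestorCount_cellNeighbours hM hc hc']
  have hS : ∀ q ∈ cellNeighbours (M ^ n) c ×ˢ cellNeighbours (M ^ n) c',
      q.1 < M ^ n ∧ q.2 < M ^ n := fun q hq =>
    ⟨lt_of_mem_cellNeighbours hc (Finset.mem_product.1 hq).1,
      lt_of_mem_cellNeighbours hc' (Finset.mem_product.1 hq).2⟩
  rw [← hF.measureReal_forall_mem_generation hp n _ hS, ← probReal_compl_eq_one_sub]
  · congr 2
    ext ω
    simp only [mem_ofPred_eq, mem_compl_iff, not_forall, exists_prop]
  · have : {ω | ∀ q ∈ cellNeighbours (M ^ n) c ×ˢ cellNeighbours (M ^ n) c',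
        gridWord M n q.1 q.2 ∈ generation keep ω n} =
        ⋂ q ∈ cellNeighbours (M ^ n) c ×ˢ cellNeighbours (M ^ n) c',
          {ω | gridWord M n q.1 q.2 ∈ generation keep ω n} := by
      ext ω; simp
    rw [this]
    exact Finset.measurableSet_biInter _ fun q _ => hF.measurableSet_mem_generation n q.1 q.2

theorem IsFractalPercolation.integrable_percolationStep
    (hF : IsFractalPercolation μ M 2 p keep) (n : ℕ) (k : Fin 3) :
    Integrable (fun ω => intrinsicVolume (d := 2) k (percolationStep keep n ω)) μ := by
  simp only [percolationStep_eq_gridUnion]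
  exact (integrable_and_integral_intrinsicVolume_gridUnion (pow_pos (NeZero.pos M) n)
    (fun ω a b => gridWord M n a b ∈ generation keep ω n)
    (fun a b => hF.measurableSet_mem_generation n a b) k).1

theorem IsFractalPercolation.integral_percolationStep_one
    (hF : IsFractalPercolation μ M 2 p keep) (hp : 0 ≤ p) (hM : 2 ≤ M) (n : ℕ) :
    ∫ ω, intrinsicVolume (d := 2) 1 (percolationStep keep n ω) ∂μ =
      ∑ c ∈ cells (M ^ n), ∑ c' ∈ cells (M ^ n),
        (2 * p ^ n - p ^ (n + cellDepth M n c + cellDepth M n c' +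
          min (cellDepth M n c) (cellDepth M n c'))) *
        prodValue (cellValue (M ^ n) c) (cellValue (M ^ n) c') 1 := by
  simp only [percolationStep_eq_gridUnion]
  rw [(integrable_and_integral_intrinsicVolume_gridUnion (pow_pos (NeZero.pos M) n)
    (fun ω a b => gridWord M n a b ∈ generation keep ω n)
    (fun a b => hF.measurableSet_mem_generation n a b) 1).2]
  refine Finset.sum_congr rfl fun c hc => Finset.sum_congr rfl fun c' hc' => ?_
  by_cases h0 : prodValue (cellValue (M ^ n) c) (cellValue (M ^ n) c') 1 = 0
  · simp [h0]
  rw [← ancestorCount_cellNeighbours hM hc hc']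
  have hS : ∀ q ∈ cellNeighbours (M ^ n) c ×ˢ cellNeighbours (M ^ n) c',
      q.1 < M ^ n ∧ q.2 < M ^ n := fun q hq =>
    ⟨lt_of_mem_cellNeighbours hc (Finset.mem_product.1 hq).1,
      lt_of_mem_cellNeighbours hc' (Finset.mem_product.1 hq).2⟩
  rw [← hF.measureReal_exists_mem_generation hp n _ hS
    (card_cellNeighbours_prod_of_value_ne_zero hM hc hc' h0)]

/-- The signed sum `∑ (-1)^(dim c) p^(n + depth c)` over the cells of a grid on the line. -/
noncomputable def lineSum (M : ℕ) (p : ℝ) (n : ℕ) : ℝ :=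
  ∑ c ∈ cells (M ^ n), (cellValue (M ^ n) c).1 * p ^ (n + cellDepth M n c)

theorem IsFractalPercolation.integral_percolationCompl_one
    (hF : IsFractalPercolation μ M 2 p keep) (hp : 0 ≤ p) (hM : 2 ≤ M) (n : ℕ) :
    ∫ ω, intrinsicVolume (d := 2) 1 (percolationCompl keep n ω) ∂μ = 2 - 2 * lineSum M p n := by
  rw [(hF.integrable_and_integral_percolationCompl hp hM n 1).2,
    sum_prodValue_one hM n fun u v => 1 - p ^ (n + u + v + min u v)]
  simp only [mul_sub, Finset.sum_sub_distrib, mul_one, sum_cellValue_fst, add_zero, Nat.zero_min,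
    Nat.min_zero]
  rw [lineSum]
  ring

theorem IsFractalPercolation.integral_percolationStep_one_eq
    (hF : IsFractalPercolation μ M 2 p keep) (hp : 0 ≤ p) (hM : 2 ≤ M) (n : ℕ) :
    ∫ ω, intrinsicVolume (d := 2) 1 (percolationStep keep n ω) ∂μ =
      4 * p ^ n - 2 * lineSum M p n := by
  rw [hF.integral_percolationStep_one hp hM n,
    sum_prodValue_one hM n fun u v => 2 * p ^ n - p ^ (n + u + v + min u v)]
  simp only [mul_sub, Finset.sum_sub_distrib, ← Finset.sum_mul, sum_cellValue_fst, add_zero,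
    Nat.zero_min, Nat.min_zero]
  rw [lineSum]
  ring

/-- The signed sum over the cells of a grid in the plane of the probabilities that all squares
around a cell are kept. -/
noncomputable def planeSum (M : ℕ) (p : ℝ) (n : ℕ) : ℝ :=
  ∑ c ∈ cells (M ^ n), ∑ c' ∈ cells (M ^ n), (cellValue (M ^ n) c).1 * ((cellValue (M ^ n) c').1 *
    p ^ (n + cellDepth M n c + cellDepth M n c' + min (cellDepth M n c) (cellDepth M n c')))

theorem IsFractalPercolation.integral_percolationCompl_zero
    (hF : IsFractalPercolation μ M 2 p keep) (hp : 0 ≤ p) (hM : 2 ≤ M) (n : ℕ) :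
    ∫ ω, intrinsicVolume (d := 2) 0 (percolationCompl keep n ω) ∂μ = 1 - planeSum M p n := by
  rw [(hF.integrable_and_integral_percolationCompl hp hM n 0).2, sum_prodValue_zero]
  simp only [sub_mul, one_mul, Finset.sum_sub_distrib, ← Finset.mul_sum, sum_cellValue_fst,
    mul_one]
  congr 1
  refine Finset.sum_congr rfl fun c _ => Finset.sum_congr rfl fun c' _ => ?_
  ring

end Expectation

/-! ### Evaluation of the sums over cells -/

theorem sum_range_mul_eq_sum_sum (m M : ℕ) (g : ℕ → ℝ) :
    ∑ i ∈ Finset.range (m * M), g i =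
      ∑ a ∈ Finset.range m, ∑ r ∈ Finset.range M, g (a * M + r) := by
  induction m with
  | zero => simp
  | succ m ih => rw [Nat.succ_mul, Finset.sum_range_add, ih, Finset.sum_range_succ]

/-- Write `i = a * M + r`: the `M - 1` nonzero remainders give multiplicity 0, and `r = 0` gives one
more than the multiplicity of `a`. Hence the induction shifts `f`. -/
theorem sum_multiplicity {M : ℕ} (hM : 2 ≤ M) (n : ℕ) (f : ℕ → ℝ) :
    ∑ i ∈ Finset.range (M ^ n), (if 0 < i then f (multiplicity M i + 1) else 0) =
      ∑ j ∈ Finset.range n, ((M : ℝ) - 1) * (M : ℝ) ^ (n - 1 - j) * f (j + 1) := by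
  induction n generalizing f with
  | zero => simp
  | succ n ih =>
    have hM0 : 0 < M := by omega
    obtain ⟨m, rfl⟩ : ∃ m, M = m + 1 := ⟨M - 1, by omega⟩
    have hinner : ∀ a, ∑ r ∈ Finset.range (m + 1),
        (if 0 < a * (m + 1) + r then f (multiplicity (m + 1) (a * (m + 1) + r) + 1) else 0) =
        m * f 1 + if 0 < a then f (multiplicity (m + 1) a + 1 + 1) else 0 := by
      intro a
      rw [Finset.sum_range_succ']
      congr 1
      · refine (Finset.sum_eq_card_nsmul fun r hr => ?_).trans
          ((nsmul_eq_mul _ _).trans (by rw [Finset.card_range]))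
        rw [Finset.mem_range] at hr
        rw [if_pos (by omega), multiplicity_eq_zero.2]
        intro hdvd
        rw [Nat.dvd_add_right (Dvd.intro_left _ rfl)] at hdvd
        have := Nat.le_of_dvd (by omega) hdvd
        omega
      · rw [add_zero]
        rcases Nat.eq_zero_or_pos a with rfl | ha
        · simp
        · have hfin : FiniteMultiplicity (m + 1) a := Nat.finiteMultiplicity_iff.2 ⟨by omega, ha⟩
          have hfin' : FiniteMultiplicity (m + 1) (a * (m + 1)) :=
            Nat.finiteMultiplicity_iff.2 ⟨by omega, by positivity⟩
          have : multiplicity (m + 1) (a * (m + 1)) = multiplicity (m + 1) a + 1 := by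
            refine multiplicity_eq_of_dvd_of_not_dvd ?_ ?_
            · rw [pow_succ]
              exact Nat.mul_dvd_mul_right (pow_multiplicity_dvd _ _) _
            · rw [pow_succ]
              intro h
              exact hfin.not_pow_dvd_of_multiplicity_lt (Nat.lt_succ_self _)
                (Nat.dvd_of_mul_dvd_mul_right hM0 h)
          rw [if_pos (by positivity), if_pos ha, this]
    rw [pow_succ, sum_range_mul_eq_sum_sum]
    simp only [hinner, Finset.sum_add_distrib]
    rw [ih (fun u => f (u + 1)), Finset.sum_range_succ', add_comm]
    congr 1
    · refine Finset.sum_congr rfl fun j hj => ?_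
      rw [show n + 1 - 1 - (j + 1) = n - 1 - j by omega]
    · simp
      ring

/-- Sums over the cells of a grid on the line, grouped by the depth of the cells. -/
theorem sum_cells_depth {M : ℕ} (hM : 2 ≤ M) (n : ℕ) (f : ℕ → ℝ) :
    ∑ c ∈ cells (M ^ n), (cellValue (M ^ n) c).1 * f (cellDepth M n c) =
      (2 - (M : ℝ) ^ n) * f 0 +
        ∑ j ∈ Finset.range n, ((M : ℝ) - 1) * (M : ℝ) ^ (n - 1 - j) * f (j + 1) := by
  have hN : 0 < M ^ n := pow_pos (by omega) n
  have h0 : ∑ i ∈ Finset.range (M ^ n), f (cellDepth M n (.inr i)) =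
      f 0 + ∑ i ∈ Finset.range (M ^ n), if 0 < i then f (multiplicity M i + 1) else 0 := by
    obtain ⟨m, hm⟩ : ∃ m, M ^ n = m + 1 := ⟨M ^ n - 1, by omega⟩
    rw [hm, Finset.sum_range_succ', Finset.sum_range_succ', add_comm]
    simp only [lt_self_iff_false, if_false, add_zero]
    congr 1
    · refine Finset.sum_congr rfl fun i hi => ?_
      rw [Finset.mem_range] at hi
      rw [cellDepth, if_pos (by omega), if_pos (by omega)]
  have h1 : cellDepth M n (.inr (M ^ n)) = 0 := by simp [cellDepth]
  have h2 : ∀ i, cellDepth M n (.inl i) = 0 := fun i => rfl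
  -- The coefficient `2 - M ^ n` collects the depth 0 cells: the two end points of `[0, 1]` and the
  -- `M ^ n` open intervals.
  rw [sum_cells, ← sum_multiplicity hM, Finset.sum_range_succ]
  simp only [cellValue, one_mul, h0, h1, h2, Finset.sum_const, Finset.card_range, nsmul_eq_mul]
  push_cast
  ring

/-- Sums over the cells of a grid on the line, normalized by the number of intervals. -/
theorem sum_cells_depth_div {M : ℕ} (hM : 2 ≤ M) (n : ℕ) (f : ℕ → ℝ) :
    (∑ c ∈ cells (M ^ n), (cellValue (M ^ n) c).1 * f (cellDepth M n c)) / (M : ℝ) ^ n =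
      (2 * (1 / (M : ℝ)) ^ n - 1) * f 0 +
        ∑ j ∈ Finset.range n, ((M : ℝ) - 1) * (1 / (M : ℝ)) ^ (j + 1) * f (j + 1) := by
  have hM0 : (M : ℝ) ≠ 0 := by positivity
  rw [sum_cells_depth hM, add_div, Finset.sum_div]
  congr 1
  · rw [one_div, inv_pow]
    field_simp
  · refine Finset.sum_congr rfl fun j hj => ?_
    rw [Finset.mem_range] at hj
    have : (M : ℝ) ^ n = (M : ℝ) ^ (n - 1 - j) * (M : ℝ) ^ (j + 1) := by
      rw [← pow_add]; congr 1; omega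
    rw [this, one_div, inv_pow]
    field_simp

/-! ### Limits -/

theorem tendsto_sum_range_pow_succ {t : ℝ} (h0 : 0 ≤ t) (h1 : t < 1) :
    Tendsto (fun n => ∑ j ∈ Finset.range n, t ^ (j + 1)) atTop (𝓝 (t / (1 - t))) := by
  have := ((hasSum_geometric_of_lt_one h0 h1).mul_left t).tendsto_sum_nat
  simpa [pow_succ', div_eq_mul_inv] using this

theorem lineSum_div {M : ℕ} (hM : 2 ≤ M) {p : ℝ} (hp : 0 < p) (n : ℕ) :
    lineSum M p n / (M * p) ^ n = (2 * (1 / (M : ℝ)) ^ n - 1) +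
      (M - 1) * ∑ j ∈ Finset.range n, (p / M) ^ (j + 1) := by
  have h := sum_cells_depth_div hM n (fun u => p ^ u)
  have : lineSum M p n / (M * p) ^ n = (∑ c ∈ cells (M ^ n), (cellValue (M ^ n) c).1 *
      p ^ cellDepth M n c) / (M : ℝ) ^ n := by
    rw [lineSum, mul_pow, mul_comm, ← div_div, Finset.sum_div]
    congr 1
    refine Finset.sum_congr rfl fun c _ => ?_
    rw [pow_add]
    field_simp
  rw [this, h, pow_zero, mul_one, Finset.mul_sum]
  congr 1
  refine Finset.sum_congr rfl fun j _ => ?_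
  rw [div_pow p, one_div, inv_pow]
  ring

theorem tendsto_one_div_pow {M : ℕ} (hM : 2 ≤ M) :
    Tendsto (fun n : ℕ => (1 / (M : ℝ)) ^ n) atTop (𝓝 0) := by
  have : (1 : ℝ) < M := by exact_mod_cast hM
  refine tendsto_pow_atTop_nhds_zero_of_lt_one (by positivity) ?_
  rwa [div_lt_one (by positivity)]

theorem tendsto_lineSum_div {M : ℕ} (hM : 2 ≤ M) {p : ℝ} (hp : 0 < p) (hp1 : p ≤ 1) :
    Tendsto (fun n => lineSum M p n / (M * p) ^ n) atTop
      (𝓝 (-1 + (M - 1) * (p / M / (1 - p / M)))) := by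
  have hM' : (1 : ℝ) < M := by exact_mod_cast hM
  have ht : p / M < 1 := by rw [div_lt_one (by positivity)]; linarith
  simp only [lineSum_div hM hp]
  have h := (((tendsto_one_div_pow hM).const_mul 2).sub_const 1).add
    ((tendsto_sum_range_pow_succ (by positivity) ht).const_mul ((M : ℝ) - 1))
  simpa using h

/-- The normalized contribution of the points of the grid in the interior of the unit square. -/
noncomputable def vertexSum (p t : ℝ) (n : ℕ) : ℝ :=
  ∑ j ∈ Finset.range n, ∑ k ∈ Finset.range n, t ^ (j + 1) * t ^ (k + 1) * p ^ (min j k + 1)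

/-- Raising both indices by one multiplies a summand by `t ^ 2 * p`; the remaining terms have `j =
0` or `k = 0`, where the exponent of `p` is 1. -/
theorem vertexSum_succ (p t : ℝ) (n : ℕ) : vertexSum p t (n + 1) = t ^ 2 * p * vertexSum p t n +
    (2 * (t ^ 2 * p) * ∑ j ∈ Finset.range n, t ^ (j + 1) + t ^ 2 * p) := by
  simp only [vertexSum, Finset.sum_range_succ', Finset.sum_add_distrib, Finset.mul_sum]
  have h1 : ∀ j k : ℕ, t ^ (j + 1 + 1) * t ^ (k + 1 + 1) * p ^ (min (j + 1) (k + 1) + 1) =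
      t ^ 2 * p * (t ^ (j + 1) * t ^ (k + 1) * p ^ (min j k + 1)) := by
    intro j k
    rw [← Nat.succ_eq_add_one j, ← Nat.succ_eq_add_one k, Nat.succ_min_succ]
    simp only [Nat.succ_eq_add_one]
    ring
  have h2 : ∑ j ∈ Finset.range n, t ^ (j + 1 + 1) * t ^ (0 + 1) * p ^ (min (j + 1) 0 + 1) =
      ∑ j ∈ Finset.range n, t ^ 2 * p * t ^ (j + 1) :=
    Finset.sum_congr rfl fun j _ => by simp; ring
  have h3 : ∑ j ∈ Finset.range n, t ^ (0 + 1) * t ^ (j + 1 + 1) * p ^ (min 0 (j + 1) + 1) =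
      ∑ j ∈ Finset.range n, t ^ 2 * p * t ^ (j + 1) :=
    Finset.sum_congr rfl fun j _ => by simp; ring
  have h4 : ∑ j ∈ Finset.range n, 2 * (t ^ 2 * p) * t ^ (j + 1) =
      2 * ∑ j ∈ Finset.range n, t ^ 2 * p * t ^ (j + 1) := by
    rw [Finset.mul_sum]
    exact Finset.sum_congr rfl fun j _ => by ring
  rw [h2, h3, h4]
  simp only [h1]
  simp
  ring

/-- Convergence of a perturbed geometric recursion. -/
theorem tendsto_of_recursion {q b : ℝ} {x y : ℕ → ℝ} (hq0 : 0 ≤ q) (hq1 : q < 1)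
    (hx : ∀ n, x (n + 1) = q * x n + y n) (h0 : x 0 = 0) (hy0 : 0 ≤ y 0) (hy : Monotone y)
    (hb : Tendsto y atTop (𝓝 b)) : Tendsto x atTop (𝓝 (b / (1 - q))) := by
  have hq : 0 < 1 - q := by linarith
  have hyb : ∀ n, y n ≤ b := hy.ge_of_tendsto hb
  -- An increasing forcing term makes `x` increasing, and the fixed point `b / (1 - q)` bounds it.
  -- So `x` converges, and its limit solves `L = q * L + b`.
  have hmono : Monotone x := by
    refine monotone_nat_of_le_succ fun n => ?_
    induction n with
    | zero => rw [hx, h0]; linarith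
    | succ n ih =>
      rw [hx (n + 1)]
      nth_rewrite 1 [hx n]
      have := mul_le_mul_of_nonneg_left ih hq0
      linarith [hy n.le_succ]
  have hbdd : ∀ n, x n ≤ b / (1 - q) := by
    intro n
    induction n with
    | zero => rw [h0]; exact div_nonneg (hy0.trans (hyb 0)) hq.le
    | succ n ih =>
      rw [hx]
      have h1 := mul_le_mul_of_nonneg_left ih hq0
      have h2 : b / (1 - q) = q * (b / (1 - q)) + b := by field_simp; ring
      linarith [hyb n]
  obtain ⟨L, hL⟩ : ∃ L, Tendsto x atTop (𝓝 L) :=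
    ⟨_, tendsto_atTop_ciSup hmono ⟨b / (1 - q), by rintro _ ⟨n, rfl⟩; exact hbdd n⟩⟩
  have hL' : Tendsto (fun n => x (n + 1)) atTop (𝓝 (q * L + b)) := by
    simp only [hx]
    exact (hL.const_mul q).add hb
  have hfix := tendsto_nhds_unique (hL.comp (tendsto_add_atTop_nat 1)) hL'
  have : L = b / (1 - q) := by
    rw [eq_div_iff hq.ne']
    linarith
  rwa [← this]

theorem tendsto_vertexSum {p t : ℝ} (hp0 : 0 ≤ p) (hp1 : p ≤ 1) (ht0 : 0 ≤ t) (ht1 : t < 1) :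
    Tendsto (vertexSum p t) atTop
      (𝓝 ((2 * (t ^ 2 * p) * (t / (1 - t)) + t ^ 2 * p) / (1 - t ^ 2 * p))) := by
  have hq : t ^ 2 * p < 1 := by
    have h1 : t ^ 2 < 1 := by nlinarith
    nlinarith
  refine tendsto_of_recursion (by positivity) hq (vertexSum_succ p t) (by simp [vertexSum]) ?_ ?_
    (((tendsto_sum_range_pow_succ ht0 ht1).const_mul _).add_const _)
  · simp; positivity
  · intro m n hmn
    have : ∑ j ∈ Finset.range m, t ^ (j + 1) ≤ ∑ j ∈ Finset.range n, t ^ (j + 1) :=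
      Finset.sum_le_sum_of_subset_of_nonneg (Finset.range_mono hmn) fun _ _ _ => by positivity
    dsimp only
    gcongr

/-- `sum_cells_depth_div` is applied once per coordinate. The summands correspond to both depths
zero, exactly one positive, and both positive; `min` couples the coordinates only in the last. -/
theorem planeSum_div {M : ℕ} (hM : 2 ≤ M) {p : ℝ} (hp : 0 < p) (n : ℕ) :
    planeSum M p n / (M ^ 2 * p) ^ n = (2 * (1 / (M : ℝ)) ^ n - 1) ^ 2 +
      2 * (2 * (1 / (M : ℝ)) ^ n - 1) * ((M - 1) * ∑ j ∈ Finset.range n, (p / M) ^ (j + 1)) +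
      (M - 1) ^ 2 * vertexSum p (p / M) n := by
  set δ := 2 * (1 / (M : ℝ)) ^ n - 1 with hδ
  have hin : ∀ u : ℕ, (∑ c' ∈ cells (M ^ n), (cellValue (M ^ n) c').1 *
      p ^ (u + cellDepth M n c' + min u (cellDepth M n c'))) / (M : ℝ) ^ n =
      δ * p ^ u + ∑ k ∈ Finset.range n, ((M : ℝ) - 1) * (1 / (M : ℝ)) ^ (k + 1) *
        p ^ (u + (k + 1) + min u (k + 1)) := by
    intro u
    have := sum_cells_depth_div hM n (fun v => p ^ (u + v + min u v))
    simpa [hδ] using this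
  have h1 : planeSum M p n / (M ^ 2 * p) ^ n = (∑ c ∈ cells (M ^ n), (cellValue (M ^ n) c).1 *
      ((∑ c' ∈ cells (M ^ n), (cellValue (M ^ n) c').1 *
        p ^ (cellDepth M n c + cellDepth M n c' + min (cellDepth M n c) (cellDepth M n c'))) /
          (M : ℝ) ^ n)) / (M : ℝ) ^ n := by
    rw [planeSum, Finset.sum_div, Finset.sum_div]
    refine Finset.sum_congr rfl fun c _ => ?_
    rw [Finset.sum_div, Finset.sum_div, Finset.mul_sum, Finset.sum_div]
    refine Finset.sum_congr rfl fun c' _ => ?_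
    rw [mul_pow, add_assoc n, add_assoc n, pow_add p n, ← pow_mul, mul_comm 2 n, pow_mul]
    field_simp
  have h2 := sum_cells_depth_div hM n (fun u => δ * p ^ u + ∑ k ∈ Finset.range n,
    ((M : ℝ) - 1) * (1 / (M : ℝ)) ^ (k + 1) * p ^ (u + (k + 1) + min u (k + 1)))
  rw [h1]
  simp only [hin]
  rw [h2, ← hδ]
  have e1 : ∑ k ∈ Finset.range n, ((M : ℝ) - 1) * (1 / (M : ℝ)) ^ (k + 1) *
      p ^ (0 + (k + 1) + min 0 (k + 1)) = (M - 1) * ∑ j ∈ Finset.range n, (p / M) ^ (j + 1) := by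
    rw [Finset.mul_sum]
    refine Finset.sum_congr rfl fun k _ => ?_
    simp only [Nat.zero_min, zero_add, add_zero]
    rw [div_pow p, one_div, inv_pow]
    ring
  have e2 : ∀ j, ((M : ℝ) - 1) * (1 / (M : ℝ)) ^ (j + 1) * (δ * p ^ (j + 1) +
      ∑ k ∈ Finset.range n, ((M : ℝ) - 1) * (1 / (M : ℝ)) ^ (k + 1) *
        p ^ (j + 1 + (k + 1) + min (j + 1) (k + 1))) =
      δ * ((M - 1) * (p / M) ^ (j + 1)) + (M - 1) ^ 2 * ∑ k ∈ Finset.range n,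
        (p / M) ^ (j + 1) * (p / M) ^ (k + 1) * p ^ (min j k + 1) := by
    intro j
    rw [mul_add, Finset.mul_sum, Finset.mul_sum]
    congr 1
    · rw [div_pow p, one_div, inv_pow]
      ring
    · refine Finset.sum_congr rfl fun k _ => ?_
      rw [show min (j + 1) (k + 1) = min j k + 1 from Nat.succ_min_succ j k, div_pow p,
        div_pow p, one_div, inv_pow, inv_pow, pow_add p (j + 1 + (k + 1)), pow_add p (j + 1) (k + 1)]
      ring
  rw [e1]
  simp only [e2, Finset.sum_add_distrib, ← Finset.mul_sum, pow_zero, mul_one]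
  rw [vertexSum]
  ring

theorem tendsto_planeSum_div {M : ℕ} (hM : 2 ≤ M) {p : ℝ} (hp : 0 < p) (hp1 : p ≤ 1) :
    Tendsto (fun n => planeSum M p n / (M ^ 2 * p) ^ n) atTop
      (𝓝 (1 - 2 * ((M - 1) * (p / M / (1 - p / M))) + (M - 1) ^ 2 *
        ((2 * ((p / M) ^ 2 * p) * (p / M / (1 - p / M)) + (p / M) ^ 2 * p) /
          (1 - (p / M) ^ 2 * p)))) := by
  have hM' : (1 : ℝ) < M := by exact_mod_cast hM
  have ht0 : 0 ≤ p / M := by positivity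
  have ht : p / M < 1 := by rw [div_lt_one (by positivity)]; linarith
  simp only [planeSum_div hM hp]
  have hδ := ((tendsto_one_div_pow hM).const_mul 2).sub_const 1
  have h := ((hδ.pow 2).add ((hδ.const_mul 2).mul
    ((tendsto_sum_range_pow_succ ht0 ht).const_mul ((M : ℝ) - 1)))).add
    ((tendsto_vertexSum hp.le hp1 ht0 ht).const_mul (((M : ℝ) - 1) ^ 2))
  convert h using 2
  ring

/-- By the choice of `D`, `M ^ D = M ^ 2 * p`. -/
theorem one_div_rpow_percolationDim {M : ℕ} (hM : 2 ≤ M) {p : ℝ} (hp : 0 < p) (n k : ℕ) :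
    (1 / (M : ℝ)) ^ ((n : ℝ) * (percolationDim M 2 p - k)) =
      (M : ℝ) ^ (n * k) / ((M : ℝ) ^ 2 * p) ^ n := by
  have hM' : (1 : ℝ) < M := by exact_mod_cast hM
  have hM0 : (0 : ℝ) < M := by linarith
  have hD : (M : ℝ) ^ percolationDim M 2 p = (M : ℝ) ^ 2 * p :=
    Real.rpow_logb hM0 hM'.ne' (by positivity)
  have e : (n : ℝ) * (percolationDim M 2 p - k) =
      percolationDim M 2 p * n - ((n * k : ℕ) : ℝ) := by
    push_cast; ring
  rw [one_div, Real.inv_rpow hM0.le, e, Real.rpow_sub hM0, Real.rpow_mul hM0.le, hD,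
    Real.rpow_natCast, Real.rpow_natCast, inv_div]

theorem one_div_rpow_percolationDim_sub_one {M : ℕ} (hM : 2 ≤ M) {p : ℝ} (hp : 0 < p) (n : ℕ) :
    (1 / (M : ℝ)) ^ ((n : ℝ) * (percolationDim M 2 p - 1)) = 1 / ((M : ℝ) * p) ^ n := by
  have h := one_div_rpow_percolationDim hM hp n 1
  have hM0 : (M : ℝ) ≠ 0 := by positivity
  rw [Nat.cast_one] at h
  rw [h, mul_one, mul_pow, mul_pow, ← pow_mul, mul_comm 2 n, pow_mul]
  field_simp

theorem tendsto_one_div_pow_of_one_lt {x : ℝ} (hx : 1 < x) :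
    Tendsto (fun n : ℕ => 1 / x ^ n) atTop (𝓝 0) := by
  have := tendsto_pow_atTop_nhds_zero_of_lt_one (r := x⁻¹) (by positivity) (inv_lt_one_of_one_lt₀ hx)
  simpa using this

theorem mainTheorem4 {Ω : Type*} [MeasurableSpace Ω] (μ : Measure Ω) [IsProbabilityMeasure μ]
    (M : ℕ) (hM : 2 ≤ M) (p : ℝ) (hp : p ∈ Icc (0 : ℝ) 1)
    (keep : List (Letter M 2) × Letter M 2 → Set Ω)
    (hF : IsFractalPercolation μ M 2 p keep) :
    (1 / (M : ℝ) ^ 2 < p →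
      (∀ n : ℕ, Integrable (fun ω => intrinsicVolume 0 (percolationCompl keep n ω)) μ) ∧
      Tendsto
        (fun n : ℕ => (1 / (M : ℝ)) ^ ((n : ℝ) * (percolationDim M 2 p - 0)) *
          ∫ ω, intrinsicVolume 0 (percolationCompl keep n ω) ∂μ)
        atTop
        (𝓝 ((M : ℝ) ^ 2 * (1 - p) * (p ^ 3 + ((M : ℝ) - 1) * p ^ 2 + ((M : ℝ) - 1) * p - (M : ℝ)) /
          (((M : ℝ) ^ 2 - p ^ 3) * ((M : ℝ) - p))))) ∧
    (1 / (M : ℝ) < p →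
      (∀ n : ℕ, Integrable (fun ω => intrinsicVolume 1 (percolationCompl keep n ω)) μ) ∧
      Tendsto
        (fun n : ℕ => (1 / (M : ℝ)) ^ ((n : ℝ) * (percolationDim M 2 p - 1)) *
          ∫ ω, intrinsicVolume 1 (percolationCompl keep n ω) ∂μ)
        atTop
        (𝓝 (2 * (M : ℝ) * (1 - p) / ((M : ℝ) - p))) ∧
      (∀ n : ℕ, Integrable (fun ω => intrinsicVolume 1 (percolationStep keep n ω)) μ) ∧
      Tendsto
        (fun n : ℕ => (1 / (M : ℝ)) ^ ((n : ℝ) * (percolationDim M 2 p - 1)) *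
          ∫ ω, intrinsicVolume 1 (percolationStep keep n ω) ∂μ)
        atTop
        (𝓝 (2 * (M : ℝ) * (1 - p) / ((M : ℝ) - p)))) := by
  have : NeZero M := ⟨by omega⟩
  have hM' : (1 : ℝ) < M := by exact_mod_cast hM
  have hM0 : (0 : ℝ) < M := by linarith
  have hMp : (M : ℝ) - p ≠ 0 := by linarith [hp.2]
  refine ⟨fun hpM => ⟨fun n => (hF.integrable_and_integral_percolationCompl hp.1 hM n 0).1, ?_⟩,
    fun hpM => ⟨fun n => (hF.integrable_and_integral_percolationCompl hp.1 hM n 1).1, ?_,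
      fun n => hF.integrable_percolationStep n 1, ?_⟩⟩
  · have hp0 : 0 < p := lt_trans (by positivity) hpM
    have hx : 1 < (M : ℝ) ^ 2 * p := by
      rw [div_lt_iff₀ (by positivity)] at hpM
      linarith
    -- The hypothesis `1 / M ^ 2 < p` serves to make the rescaled constant 1 in `1 - planeSum`
    -- vanish.
    have h := (tendsto_one_div_pow_of_one_lt hx).sub (tendsto_planeSum_div hM hp0 hp.2)
    have hp3 : (M : ℝ) ^ 2 - p ^ 3 ≠ 0 := by
      have h1 : p ^ 3 ≤ 1 := pow_le_one₀ hp.1 hp.2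
      nlinarith
    convert h using 2 with n
    · have e := one_div_rpow_percolationDim hM hp0 n 0
      rw [Nat.cast_zero] at e
      rw [e, hF.integral_percolationCompl_zero hp.1 hM n]
      ring
    · have h1 : 1 - p / M = (M - p) / M := by field_simp
      have h2 : 1 - (p / M) ^ 2 * p = (M ^ 2 - p ^ 3) / M ^ 2 := by field_simp
      rw [h1, h2]
      field_simp
      ring
  all_goals
    have hp0 : 0 < p := lt_trans (by positivity) hpM
    have hx : 1 < (M : ℝ) * p := by
      rw [div_lt_iff₀ hM0] at hpM
      linarith
    have h1 : 1 - p / M = (M - p) / M := by field_simp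
  · have h := ((tendsto_one_div_pow_of_one_lt hx).const_mul 2).sub
      ((tendsto_lineSum_div hM hp0 hp.2).const_mul 2)
    convert h using 2 with n
    · rw [one_div_rpow_percolationDim_sub_one hM hp0, hF.integral_percolationCompl_one hp.1 hM n]
      ring
    · rw [h1]
      field_simp
      ring
  -- The term `4 * p ^ n` rescales to `4 * (1 / M) ^ n`, which tends to zero.
  · have h := ((tendsto_one_div_pow hM).const_mul 4).sub
      ((tendsto_lineSum_div hM hp0 hp.2).const_mul 2)
    convert h using 2 with n
    · rw [one_div_rpow_percolationDim_sub_one hM hp0, hF.integral_percolationStep_one_eq hp.1 hM n,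
        mul_sub, mul_pow, one_div_pow]
      field_simp
    · rw [h1]
      field_simp
      ring
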